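/- Let $k$ be a field of characteristic $0$, $\lambda\in k^\times$, and $\varphi(z)=\sum_{r=0}^{l}a_rz^r\in k[z]$ a nonzero polynomial of degree $l$. For a unit $\lambda$ of a commutative ring $R$ and $\varphi\in R[z]$, the generalized Weyl algebra $R[z;\lambda,0,\varphi]$ is generated over $R[z]$ by $x,y$ with $xb=\sigma(b)x$, $yb=\sigma^{-1}(b)y$ ($b\in R[z]$), $yx=\varphi$, $xy=\sigma(\varphi)$, where $\sigma$ is the $R$-algebra automorphism of $R[z]$ with $\sigma(z)=\lambda z$. Let $A=k[z;\lambda,0,\varphi(z)]$ and assume that $A$ is noncommutative, i.e. $\lambda\ne1$. Put $\bar\varphi=\sigma(\varphi)$, $x_q=x^q$ for $q\ge0$, $x_q=y^{-q}$ for $q<0$. Notation. For a bilinear map $F\colon A\times A\to A$ put $\mathsf bF(a,b,c)=aF(b,c)-F(ab,c)+F(a,bc)-F(a,b)c$, and $F\bullet G(a,b,c)=F(G(a,b),c)-F(a,G(b,c))$; $F$ is a Hochschild $2$-cocycle if $\mathsf bF=0$. Write $(a\otimes b)\cdot m=amb$, and for $f,g\in\{\mathrm{id},\sigma\}$ let ${}^f\!\Delta^g(z^r)=\sum_{i=1}^{r}f(z^{r-i})\otimes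 g(z^{i-1})$, extended linearly. A quadruple $(m_1,m_2,m_3,m_4)\in A^4$ is a Per $2$-cocycle if $$-ym_1-\lambda m_2x+zm_3-m_3z=0,\qquad -\lambda^{-1}m_1y-xm_2+\lambda^{-1}(\sigma(z)m_4-m_4\sigma(z))=0,$$ $$-{}^\sigma\!\Delta(\varphi)\cdot m_1+xm_3-m_4x=0,\qquad -\lambda\,\Delta^\sigma(\varphi)\cdot m_2-m_3y+ym_4=0.$$ Put $f(z)=(\lambda zx,\,-yz,\,0,\,-\lambda\,{}^\sigma\!\Delta^\sigma(\varphi)\cdot z)$. A Hochschild $2$-cocycle $F$ corresponds to a Per $2$-cocycle $(m_1,m_2,m_3,m_4)$ (through the comparison between the bar resolution and the periodic resolution of $A$) if, for all $p,q,i,j\ge0$, \begin{align*} F(z^px^q,z^ix^j)&=-\sum_{r=1}^{i}\sum_{s=1}^{q}z^p\sigma^q(z)^{i-r}x^{q-s}\,m_1\,(\lambda x)^{s-1}z^{r-1}x^j,\\ F(z^py^q,z^iy^j)&=-\sum_{r=1}^{i}\sum_{s=1}^{q}z^p\sigma^{-q}(z)^{i-r}y^{q-s}\,m_2\,(\lambda^{-1}y)^{s-1}z^{r-1}y^j,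 \end{align*} and, for all $p,i\ge0$, $j\ge1$, \begin{align*} F(z^px,z^iy^j)&=-\sum_{r=1}^{i}z^p\sigma(z)^{i-r}\,m_1\,z^{r-1}y^j+z^p\sigma(z)^i\,m_4\,y^{j-1},\\ F(z^py,z^ix^j)&=-\sum_{r=1}^{i}z^p\sigma^{-1}(z)^{i-r}\,m_2\,z^{r-1}x^j+z^p\sigma^{-1}(z)^i\,m_3\,x^{j-1}. \end{align*} Let $\Gamma^nA$ be the span of all $z^px_q$ with $p\ge0$, $q\in\mathbb Z$, $\|z^px_q\|:=p+(l+1)|q|\le n$; $F$ preserves $\Gamma$ if $F(b_1,b_2)\in\Gamma^{\|b_1\|+\|b_2\|}A$ for all $b_1,b_2$ of the form $z^px_q$. Consider, for a bilinear map $F$, the conditions (a) $F(u,1)=F(1,v)=0$ for all $u,v\in A$; (b) $F(zu,v)=zF(u,v)$ for all $u,v\in A$, and $F(x^q,x^j)=F(y^q,y^j)=0$ for all $q,j\ge0$. Theorem. The quadruple $f(z)$ is a Per $2$-cocycle, and there is exactly one Hochschild $2$-cocycle $F_1$ corresponding to it. There is exactly one family of $k$-bilinear maps $F_n\colon A\times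 A\to A$, $n\ge2$, such that 1. the $F_n$ integrate $F_1$: $\sum_{i=1}^{n-1}F_i\bullet F_{n-i}=\mathsf bF_n$ for all $n\ge2$; 2. every $F_n$, $n\ge2$, satisfies (a) and (b); 3. for all $n\ge2$: $F_n(x,z)=0$, $F_n(y,z)=yz$, $F_n(x,y)=\frac{(-1)^n}{n!}z^n\bar\varphi^{(n)}(z)$, $F_n(y,x)=0$. Moreover all $F_n$, $n\geq1$, preserve $\Gamma$. The $k[[\tau]]$-bilinear multiplication on $A[[\tau]]$ that extends $u*v=uv+\sum_{n\ge1}F_n(u,v)\tau^n$ ($u,v\in A$), i.e. the one for which the coefficient of $\tau^n$ in $\bigl(\sum_i u_i\tau^i\bigr)*\bigl(\sum_j v_j\tau^j\bigr)$ is $\sum_{m+i+j=n}F_m(u_i,v_j)$ with $F_0$ the multiplication of $A$, is associative with identity $1_A$ (a formal deformation of $A$). It is locally finite: $\sum_{n\ge1}kF_n(u,v)$ is finite dimensional for all $u,v\in A$, so that the $k[[\tau]]$-submodule $\tilde A=A\otimes k[[\tau]]$ of $A[[\tau]]$ generated by $A$ is a subalgebra. The locally finite deformation $\tilde A_\tau$,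 i.e. the localization of $\tilde A$ at $\tau$, is isomorphic as a $k((\tau))$-algebra, by an isomorphism that maps $x,y,z$ to $x,y,z$, to the generalized Weyl algebra $k((\tau))[z;(1-\tau)\lambda,0,\varphi(z)]$, which is quantum, i.e. $(1-\tau)\lambda\neq1$. -/

import Mathlib

open scoped Polynomial PowerSeries LaurentSeries TensorProduct

/-! ### Generalized Weyl algebras -/

/-- The generators of the generalized Weyl algebra `B(σ, a)`: the elements of `B`, and `x`, `y`. -/
inductive GWAGen (B : Type*) : Type _
  | base (b : B) : GWAGen B
  | x : GWAGen B
  | y : GWAGen B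

section GWA

variable (R : Type*) [CommRing R] {B : Type*} [CommRing B] [Algebra R B]

/-- The relations of `B(σ, a)`. The first three say that `B` maps to it by an algebra morphism. -/
inductive GWARel (σ : B ≃ₐ[R] B) (a : B) :
    FreeAlgebra R (GWAGen B) → FreeAlgebra R (GWAGen B) → Prop
  | base_add (b c : B) : GWARel σ a (FreeAlgebra.ι R (.base (b + c)))
      (FreeAlgebra.ι R (.base b) + FreeAlgebra.ι R (.base c))
  | base_mul (b c : B) : GWARel σ a (FreeAlgebra.ι R (.base (b * c)))
      (FreeAlgebra.ι R (.base b) * FreeAlgebra.ι R (.base c))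
  | base_algebraMap (r : R) : GWARel σ a (FreeAlgebra.ι R (.base (algebraMap R B r)))
      (algebraMap R (FreeAlgebra R (GWAGen B)) r)
  | x_base (b : B) : GWARel σ a (FreeAlgebra.ι R .x * FreeAlgebra.ι R (.base b))
      (FreeAlgebra.ι R (.base (σ b)) * FreeAlgebra.ι R .x)
  | y_base (b : B) : GWARel σ a (FreeAlgebra.ι R .y * FreeAlgebra.ι R (.base b))
      (FreeAlgebra.ι R (.base (σ.symm b)) * FreeAlgebra.ι R .y)
  | y_x : GWARel σ a (FreeAlgebra.ι R .y * FreeAlgebra.ι R .x) (FreeAlgebra.ι R (.base a))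
  | x_y : GWARel σ a (FreeAlgebra.ι R .x * FreeAlgebra.ι R .y) (FreeAlgebra.ι R (.base (σ a)))

/-- The generalized Weyl algebra `B(σ, a)` over the commutative `R`-algebra `B`: the `R`-algebra
generated over `B` by `x`, `y` subject to `x b = σ(b) x`, `y b = σ⁻¹(b) y`, `y x = a`,
`x y = σ(a)`. -/
abbrev GWA (σ : B ≃ₐ[R] B) (a : B) : Type _ := RingQuot (GWARel R σ a)

/-- The structure morphism `B → B(σ, a)`. -/
def GWA.ofBase (σ : B ≃ₐ[R] B) (a : B) : B →ₐ[R] GWA R σ a :=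
  let f : B → GWA R σ a := fun b =>
    RingQuot.mkAlgHom R (GWARel R σ a) (FreeAlgebra.ι R (.base b))
  have hadd : ∀ b c, f (b + c) = f b + f c := fun b c => by
    simp only [f, ← map_add]
    exact RingQuot.mkAlgHom_rel R (.base_add b c)
  have hmul : ∀ b c, f (b * c) = f b * f c := fun b c => by
    simp only [f, ← map_mul]
    exact RingQuot.mkAlgHom_rel R (.base_mul b c)
  have halg : ∀ r, f (algebraMap R B r) = algebraMap R _ r := fun r => by
    simp only [f]
    rw [RingQuot.mkAlgHom_rel R (GWARel.base_algebraMap (σ := σ) (a := a) r), AlgHom.commutes]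
  { toFun := f
    map_one' := by simpa using halg 1
    map_mul' := hmul
    map_zero' := by simpa using halg 0
    map_add' := hadd
    commutes' := halg }

/-- The generator `x` of `B(σ, a)`. -/
def GWA.x (σ : B ≃ₐ[R] B) (a : B) : GWA R σ a :=
  RingQuot.mkAlgHom R (GWARel R σ a) (FreeAlgebra.ι R .x)

/-- The generator `y` of `B(σ, a)`. -/
def GWA.y (σ : B ≃ₐ[R] B) (a : B) : GWA R σ a :=
  RingQuot.mkAlgHom R (GWARel R σ a) (FreeAlgebra.ι R .y)

end GWA

section PolyGWA

variable {k : Type*} [CommRing k]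

/-- The automorphism `σ` of `k[z]` with `σ(z) = lam z + eta`. -/
noncomputable def sigmaAut (lam : kˣ) (eta : k) : k[X] ≃ₐ[k] k[X] :=
  letI := lam.invertible
  Polynomial.algEquivCMulXAddC (lam : k) eta

/-- The generalized Weyl algebra `k[z; lam, eta, φ(z)]`. -/
abbrev PolyGWA (lam : kˣ) (eta : k) (φ : k[X]) : Type _ := GWA k (sigmaAut lam eta) φ

namespace PolyGWA

variable (lam : kˣ) (eta : k) (φ : k[X])

/-- The element `h(z)` of `A = k[z; lam, eta, φ(z)]`, for a polynomial `h`. -/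
noncomputable def ofPoly (h : k[X]) : PolyGWA lam eta φ := GWA.ofBase k (sigmaAut lam eta) φ h

/-- The generator `z`. -/
noncomputable def z : PolyGWA lam eta φ := ofPoly lam eta φ Polynomial.X

/-- The generator `x`. -/
noncomputable def x : PolyGWA lam eta φ := GWA.x k (sigmaAut lam eta) φ

/-- The generator `y`. -/
noncomputable def y : PolyGWA lam eta φ := GWA.y k (sigmaAut lam eta) φ

/-- `x_q = x ^ q` for `q ≥ 0` and `x_q = y ^ (-q)` for `q < 0`. -/
noncomputable def xPow (q : ℤ) : PolyGWA lam eta φ :=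
  if 0 ≤ q then x lam eta φ ^ q.toNat else y lam eta φ ^ (-q).toNat

/-- The basis element `z ^ p x_q`. -/
noncomputable def basisElt (p : ℕ) (q : ℤ) : PolyGWA lam eta φ :=
  z lam eta φ ^ p * xPow lam eta φ q

/-- The weight `p + (l + 1)|q|` of `z ^ p x_q`, where `l = deg φ`. -/
def weight (p : ℕ) (q : ℤ) : ℕ := p + (φ.natDegree + 1) * q.natAbs

/-- The filtration `Γ`: `Γ^n A` is spanned by the `z ^ p x_q` of weight at most `n`. -/
noncomputable def Gam (n : ℕ) : Submodule k (PolyGWA lam eta φ) :=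
  Submodule.span k {b | ∃ p q, weight φ p q ≤ n ∧ b = basisElt lam eta φ p q}

end PolyGWA

end PolyGWA

/-! ### Hochschild cochains and formal deformations -/

/-- Hochschild `2`-cochains of `A` with coefficients in `A`, as `k`-bilinear maps `A × A → A`. -/
abbrev HochschildTwo (k A : Type*) [CommRing k] [Ring A] [Algebra k A] : Type _ :=
  A →ₗ[k] A →ₗ[k] A

section Deformation

variable {k A : Type*} [CommRing k] [Ring A] [Algebra k A]

/-- The Hochschild coboundary `𝖻F` of a `2`-cochain. -/
def hochschildB (F : HochschildTwo k A) (a b c : A) : A :=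
  a * F b c - F (a * b) c + F a (b * c) - F a b * c

/-- `F` is a Hochschild `2`-cocycle. -/
def IsHochschildTwoCocycle (F : HochschildTwo k A) : Prop := ∀ a b c, hochschildB F a b c = 0

/-- The composition `F • G`. -/
def bullet (F G : HochschildTwo k A) (a b c : A) : A := F (G a b) c - F a (G b c)

/-- The family `F` (with `F 0` the multiplication of `A` and `F 1 = F₁`) integrates `F₁`:
`∑_{i=1}^{n-1} F_i • F_{n-i} = 𝖻F_n` for all `n ≥ 2`. -/
def Integrates (F₁ : HochschildTwo k A) (F : ℕ → HochschildTwo k A) : Prop :=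
  F 0 = LinearMap.mul k A ∧ F 1 = F₁ ∧
    ∀ n, 2 ≤ n → ∀ a b c,
      ∑ i ∈ Finset.Icc 1 (n - 1), bullet (F i) (F (n - i)) a b c = hochschildB (F n) a b c

/-- The multiplication on `A[[τ]]` that extends `u * v = ∑ₙ F_n(u, v) τ^n`, `u, v ∈ A`:
the coefficient of `τ^n` in `u * v` is the sum of `F_m(u_i, v_j)` over `m + i + j = n`. -/
noncomputable def starMul (F : ℕ → HochschildTwo k A) (u v : A⟦X⟧) : A⟦X⟧ :=
  PowerSeries.mk fun n =>
    ∑ m ∈ Finset.HasAntidiagonal.antidiagonal n, ∑ i ∈ Finset.HasAntidiagonal.antidiagonal m.2,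
      F m.1 (PowerSeries.coeff i.1 u) (PowerSeries.coeff i.2 v)

/-- `F` defines a formal deformation: `F 0` is the multiplication of `A`, and the multiplication
on `A[[τ]]` is associative. -/
def IsFormalDeformation (F : ℕ → HochschildTwo k A) : Prop :=
  F 0 = LinearMap.mul k A ∧
    ∀ u v w : A⟦X⟧, starMul F (starMul F u v) w = starMul F u (starMul F v w)

/-- Condition (a): `F(u, 1) = F(1, v) = 0`. -/
def CondA (F : HochschildTwo k A) : Prop := (∀ u, F u 1 = 0) ∧ ∀ v, F 1 v = 0

/-- The family `F` is locally finite: `∑_{n ≥ 1} k F_n(u, v)` is finite dimensional for all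
`u, v`. -/
def IsLocallyFinite (F : ℕ → HochschildTwo k A) : Prop :=
  ∀ u v, (Submodule.span k {w | ∃ n, 1 ≤ n ∧ w = F n u v}).FG

theorem sum_antidiag_assoc {M : Type*} [AddCommMonoid M] (f : ℕ → ℕ → ℕ → M) (n : ℕ) :
    ∑ p ∈ Finset.HasAntidiagonal.antidiagonal n,
      ∑ q ∈ Finset.HasAntidiagonal.antidiagonal p.2, f p.1 q.1 q.2 =
    ∑ p ∈ Finset.HasAntidiagonal.antidiagonal n,
      ∑ q ∈ Finset.HasAntidiagonal.antidiagonal p.1, f q.1 q.2 p.2 := by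
  rw [Finset.sum_sigma', Finset.sum_sigma']
  refine Finset.sum_nbij' (fun s => ⟨(s.1.1 + s.2.1, s.2.2), (s.1.1, s.2.1)⟩)
    (fun s => ⟨(s.2.1, s.2.2 + s.1.2), (s.2.2, s.1.2)⟩) ?_ ?_ ?_ ?_ ?_
  · rintro ⟨⟨a, b⟩, ⟨c, d⟩⟩ h
    simp at h ⊢; omega
  · rintro ⟨⟨a, b⟩, ⟨c, d⟩⟩ h
    simp at h ⊢; omega
  · rintro ⟨⟨a, b⟩, ⟨c, d⟩⟩ h
    simp at h ⊢; simp [h]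
  · rintro ⟨⟨a, b⟩, ⟨c, d⟩⟩ h
    simp at h ⊢; simp [h]
  · rintro ⟨⟨a, b⟩, ⟨c, d⟩⟩ h
    rfl

theorem sum_antidiag_left_comm {M : Type*} [AddCommMonoid M] (f : ℕ → ℕ → ℕ → M) (n : ℕ) :
    ∑ p ∈ Finset.HasAntidiagonal.antidiagonal n,
      ∑ q ∈ Finset.HasAntidiagonal.antidiagonal p.2, f p.1 q.1 q.2 =
    ∑ p ∈ Finset.HasAntidiagonal.antidiagonal n,
      ∑ q ∈ Finset.HasAntidiagonal.antidiagonal p.2, f q.1 p.1 q.2 := by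
  rw [sum_antidiag_assoc, sum_antidiag_assoc (fun a b c => f b a c)]
  refine Finset.sum_congr rfl fun p _ => ?_
  exact (Finset.Nat.sum_antidiagonal_swap (n := p.1) (f := fun q => f q.1 q.2 p.2)).symm

/-- The usual action of `k[[τ]]` on `A[[τ]]`: multiplication by the image in `A[[τ]]`. -/
noncomputable def scal (c : k⟦X⟧) (u : A⟦X⟧) : A⟦X⟧ := PowerSeries.map (algebraMap k A) c * u

theorem coeff_scal (c : k⟦X⟧) (u : A⟦X⟧) (n : ℕ) :
    PowerSeries.coeff n (scal c u) = ∑ p ∈ Finset.HasAntidiagonal.antidiagonal n,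
      PowerSeries.coeff p.1 c • PowerSeries.coeff p.2 u := by
  simp [scal, PowerSeries.coeff_mul, Algebra.smul_def]

theorem scal_one (u : A⟦X⟧) : scal (1 : k⟦X⟧) u = u := by simp [scal]

theorem scal_mul (c d : k⟦X⟧) (u : A⟦X⟧) : scal (c * d) u = scal c (scal d u) := by
  simp [scal, mul_assoc]

theorem scal_zero (c : k⟦X⟧) : scal c (0 : A⟦X⟧) = 0 := by simp [scal]

theorem zero_scal (u : A⟦X⟧) : scal (0 : k⟦X⟧) u = 0 := by simp [scal]

theorem scal_add (c : k⟦X⟧) (u v : A⟦X⟧) : scal c (u + v) = scal c u + scal c v := by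
  simp [scal, mul_add]

theorem add_scal (c d : k⟦X⟧) (u : A⟦X⟧) : scal (c + d) u = scal c u + scal d u := by
  simp [scal, add_mul]

theorem starMul_scal_left (F : ℕ → HochschildTwo k A) (c : k⟦X⟧) (u v : A⟦X⟧) :
    starMul F (scal c u) v = scal c (starMul F u v) := by
  ext n
  simp only [starMul, coeff_scal, PowerSeries.coeff_mk, map_sum, map_smul, LinearMap.sum_apply,
    LinearMap.smul_apply, Finset.smul_sum]
  rw [sum_antidiag_left_comm (fun a m r => ∑ x ∈ Finset.HasAntidiagonal.antidiagonal r,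
    PowerSeries.coeff a c • F m (PowerSeries.coeff x.1 u) (PowerSeries.coeff x.2 v))]
  refine Finset.sum_congr rfl fun m _ => ?_
  rw [sum_antidiag_assoc (fun a i j =>
    PowerSeries.coeff a c • F m.1 (PowerSeries.coeff i u) (PowerSeries.coeff j v))]

theorem starMul_scal_right (F : ℕ → HochschildTwo k A) (c : k⟦X⟧) (u v : A⟦X⟧) :
    starMul F u (scal c v) = scal c (starMul F u v) := by
  ext n
  simp only [starMul, coeff_scal, PowerSeries.coeff_mk, map_sum, map_smul, Finset.smul_sum]
  rw [sum_antidiag_left_comm (fun a m r => ∑ x ∈ Finset.HasAntidiagonal.antidiagonal r,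
    PowerSeries.coeff a c • F m (PowerSeries.coeff x.1 u) (PowerSeries.coeff x.2 v))]
  refine Finset.sum_congr rfl fun m _ => ?_
  rw [sum_antidiag_left_comm (fun a i j =>
    PowerSeries.coeff a c • F m.1 (PowerSeries.coeff i u) (PowerSeries.coeff j v))]

theorem starMul_add_left (F : ℕ → HochschildTwo k A) (u u' v : A⟦X⟧) :
    starMul F (u + u') v = starMul F u v + starMul F u' v := by
  ext n
  simp [starMul, Finset.sum_add_distrib]

theorem starMul_add_right (F : ℕ → HochschildTwo k A) (u v v' : A⟦X⟧) :
    starMul F u (v + v') = starMul F u v + starMul F u v' := by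
  ext n
  simp [starMul, Finset.sum_add_distrib]

theorem starMul_one_left (F : ℕ → HochschildTwo k A) (h0 : F 0 = LinearMap.mul k A)
    (hF : ∀ n, 1 ≤ n → CondA (F n)) (v : A⟦X⟧) : starMul F (PowerSeries.C 1) v = v := by
  ext n
  simp only [starMul, PowerSeries.coeff_mk]
  rw [Finset.sum_eq_single (0, n)]
  · rw [Finset.sum_eq_single (0, n)]
    · simp [h0]
    · rintro ⟨i, j⟩ h hne
      have : i ≠ 0 := by rintro rfl; simp at h; simp [h] at hne
      simp [this]
    · simp
  · rintro ⟨m, r⟩ h hne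
    have hm : 1 ≤ m := by
      rcases Nat.eq_zero_or_pos m with rfl | h'
      · simp at h; simp [h] at hne
      · exact h'
    refine Finset.sum_eq_zero fun i _ => ?_
    rw [PowerSeries.coeff_C]
    split_ifs
    · exact (hF m hm).2 _
    · simp
  · simp

theorem starMul_one_right (F : ℕ → HochschildTwo k A) (h0 : F 0 = LinearMap.mul k A)
    (hF : ∀ n, 1 ≤ n → CondA (F n)) (u : A⟦X⟧) : starMul F u (PowerSeries.C 1) = u := by
  ext n
  simp only [starMul, PowerSeries.coeff_mk]
  rw [Finset.sum_eq_single (0, n)]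
  · rw [Finset.sum_eq_single (n, 0)]
    · simp [h0]
    · rintro ⟨i, j⟩ h hne
      have : j ≠ 0 := by rintro rfl; simp at h; simp [h] at hne
      simp [this]
    · simp
  · rintro ⟨m, r⟩ h hne
    have hm : 1 ≤ m := by
      rcases Nat.eq_zero_or_pos m with rfl | h'
      · simp at h; simp [h] at hne
      · exact h'
    refine Finset.sum_eq_zero fun i _ => ?_
    rw [PowerSeries.coeff_C]
    split_ifs
    · exact (hF m hm).1 _
    · simp
  · simp

variable (k A) in
/-- A formal deformation of `A` whose identity element is `1 ∈ A`. -/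
structure UnitalFormalDeformation where
  /-- The family `F_n`, with `F_0` the multiplication of `A`. -/
  F : ℕ → HochschildTwo k A
  isFormalDeformation : IsFormalDeformation F
  condA : ∀ n, 1 ≤ n → CondA (F n)

namespace UnitalFormalDeformation

variable (D : UnitalFormalDeformation k A)

/-- The underlying set `A[[τ]]` of the deformed algebra `(A[[τ]], *)`. -/
def Series (_ : UnitalFormalDeformation k A) : Type _ := A⟦X⟧

noncomputable instance : AddCommGroup D.Series := inferInstanceAs (AddCommGroup A⟦X⟧)

/-- The constant power series `a`, for `a ∈ A`. -/
noncomputable def const (a : A) : D.Series := (PowerSeries.C a : A⟦X⟧)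

/-- The ring `(A[[τ]], *)`. -/
noncomputable instance : Ring D.Series :=
  { (inferInstance : AddCommGroup D.Series) with
    mul := fun u v => starMul D.F u v
    one := D.const 1
    mul_assoc := D.isFormalDeformation.2
    one_mul := starMul_one_left D.F D.isFormalDeformation.1 D.condA
    mul_one := starMul_one_right D.F D.isFormalDeformation.1 D.condA
    left_distrib := starMul_add_right D.F
    right_distrib := starMul_add_left D.F
    zero_mul := fun v => by
      have h := starMul_add_left D.F 0 0 v
      rw [add_zero] at h
      exact left_eq_add.mp h
    mul_zero := fun u => by
      have h := starMul_add_right D.F u 0 0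
      rw [add_zero] at h
      exact left_eq_add.mp h }

/-- The usual `k[[τ]]`-module structure of `A[[τ]]`. -/
noncomputable instance : Module k⟦X⟧ D.Series where
  smul c u := scal (A := A) c u
  one_smul := scal_one
  mul_smul := scal_mul
  smul_zero := scal_zero
  smul_add := scal_add
  add_smul := add_scal
  zero_smul := zero_scal

/-- `(A[[τ]], *)` is a `k[[τ]]`-algebra. -/
noncomputable instance : Algebra k⟦X⟧ D.Series :=
  Algebra.ofModule (fun c u v => starMul_scal_left D.F c u v)
    (fun c u v => starMul_scal_right D.F c u v)

/-- `Ã = A ⊗ k[[τ]]`, as a `k[[τ]]`-submodule of `A[[τ]]`: the submodule generated by `A`. -/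
noncomputable def tildeSubmodule : Submodule k⟦X⟧ D.Series :=
  Submodule.span k⟦X⟧ (Set.range D.const)

theorem const_mul_const_mem (h : IsLocallyFinite D.F) (a b : A) :
    D.const a * D.const b ∈ D.tildeSubmodule := by
  obtain ⟨s, hs⟩ := h a b
  have hmem : ∀ n, ∃ c : A → k, (n = 0 → c = 0) ∧ (1 ≤ n → D.F n a b = ∑ e ∈ s, c e • e) := by
    intro n
    rcases Nat.eq_zero_or_pos n with rfl | hn
    · exact ⟨0, fun _ => rfl, fun h => absurd h (by omega)⟩
    · have hm : D.F n a b ∈ Submodule.span k (s : Set A) :=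
        hs ▸ Submodule.subset_span ⟨n, hn, rfl⟩
      obtain ⟨c, -, hc⟩ := Submodule.mem_span_finset.1 hm
      exact ⟨c, fun h => absurd h (by omega), fun _ => hc.symm⟩
  choose c hc0 hc using hmem
  have key : starMul D.F (PowerSeries.C a) (PowerSeries.C b) =
      PowerSeries.C (a * b) + ∑ e ∈ s, scal (PowerSeries.mk fun n => c n e) (PowerSeries.C e) := by
    ext n
    have hl : PowerSeries.coeff n (starMul D.F (PowerSeries.C a) (PowerSeries.C b)) =
        D.F n a b := by
      simp only [starMul, PowerSeries.coeff_mk]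
      rw [Finset.sum_eq_single (n, 0)]
      · simp
      · rintro ⟨m, r⟩ h hne
        refine Finset.sum_eq_zero ?_
        rintro ⟨i, j⟩ h'
        simp at h h'
        have : i ≠ 0 ∨ j ≠ 0 := by
          by_contra hcon
          push Not at hcon
          exact hne (by ext <;> simp <;> omega)
        rcases this with h1 | h1 <;> simp [PowerSeries.coeff_C, h1]
      · simp
    have hr : ∀ e, PowerSeries.coeff n
        (scal (PowerSeries.mk fun n => c n e) (PowerSeries.C e)) = c n e • e := by
      intro e
      simp [scal, Algebra.smul_def]
    rw [hl, map_add, map_sum]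
    simp only [hr]
    rcases Nat.eq_zero_or_pos n with rfl | hn
    · simp [hc0 0 rfl, D.isFormalDeformation.1]
    · rw [hc n hn, PowerSeries.coeff_C, if_neg (by omega), zero_add]
  have key' : D.const a * D.const b = D.const (a * b) +
      ∑ e ∈ s, (PowerSeries.mk fun n => c n e : k⟦X⟧) • D.const e := key
  rw [key']
  exact add_mem (Submodule.subset_span ⟨_, rfl⟩)
    (sum_mem fun e _ => Submodule.smul_mem _ _ (Submodule.subset_span ⟨_, rfl⟩))

/-- If `*` is locally finite, then `Ã` is a `k[[τ]]`-subalgebra of `(A[[τ]], *)`. -/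
noncomputable def tilde (h : IsLocallyFinite D.F) : Subalgebra k⟦X⟧ D.Series :=
  D.tildeSubmodule.toSubalgebra (Submodule.subset_span ⟨1, rfl⟩) <| by
    intro u v hu hv
    have hle : D.tildeSubmodule * D.tildeSubmodule ≤ D.tildeSubmodule := by
      conv_lhs => rw [tildeSubmodule, Submodule.span_mul_span]
      rw [Submodule.span_le]
      rintro _ ⟨_, ⟨a, rfl⟩, _, ⟨b, rfl⟩, rfl⟩
      exact D.const_mul_const_mem h a b
    exact hle (Submodule.mul_mem_mul hu hv)

/-- The element `a` of `Ã`, for `a ∈ A`. -/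
noncomputable def inTilde (h : IsLocallyFinite D.F) (a : A) : D.tilde h :=
  ⟨D.const a, Submodule.subset_span ⟨a, rfl⟩⟩

end UnitalFormalDeformation

end Deformation

/-- The locally finite deformation `Ã_τ`, that is, the localization of the `k[[τ]]`-algebra `Ã` at
`τ`, realized by extending scalars from `k[[τ]]` to its localization `k((τ))` at `τ`. It is a
`k((τ))`-algebra. -/
abbrev UnitalFormalDeformation.Localized {k A : Type*} [Field k] [Ring A] [Algebra k A]
    (D : UnitalFormalDeformation k A) (h : IsLocallyFinite D.F) : Type _ :=
  k⸨X⸩ ⊗[k⟦X⟧] D.tilde h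

/-- The unit `(1 - τ) lam` of the field `k((τ))`. -/
noncomputable def deformedParam {k : Type*} [Field k] (lam : kˣ) : (k⸨X⸩)ˣ :=
  Units.mk0 (algebraMap k⟦X⟧ k⸨X⸩ ((1 - PowerSeries.X) * PowerSeries.C (lam : k))) <| by
    rw [map_ne_zero_iff _ (IsFractionRing.injective k⟦X⟧ k⸨X⸩)]
    intro h
    have h' := congrArg (PowerSeries.coeff 0) h
    simp at h'

/-! ### Per cochains and the comparison with Hochschild cochains -/

namespace PolyGWA

section Per

variable {k : Type*} [CommRing k] (lam : kˣ) (eta : k) (φ : k[X])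

/-- The action `(a ⊗ b) · m = a m b` of `A ⊗ A` on `m ∈ A`. -/
noncomputable def act (m : PolyGWA lam eta φ) :
    PolyGWA lam eta φ ⊗[k] PolyGWA lam eta φ →ₗ[k] PolyGWA lam eta φ :=
  TensorProduct.lift ((LinearMap.mul k (PolyGWA lam eta φ)) ∘ₗ
    (LinearMap.mulRight k m))

/-- The map `fΔg = (f ⊗ g) ∘ Δ₀`, where `Δ₀ : k[z] → k[z] ⊗ k[z]` is the linear map with
`Δ₀(z ^ r) = ∑_{i < r} z ^ (r - 1 - i) ⊗ z ^ i`. -/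
noncomputable def delta (f g : k[X] ≃ₐ[k] k[X]) (h : k[X]) :
    PolyGWA lam eta φ ⊗[k] PolyGWA lam eta φ :=
  h.sum fun r c => c • ∑ i ∈ Finset.range r,
    ofPoly lam eta φ (f (Polynomial.X ^ (r - 1 - i))) ⊗ₜ[k]
      ofPoly lam eta φ (g (Polynomial.X ^ i))

/-- The element `σ^q(z)` of `A`, for `q ∈ ℤ`. -/
noncomputable def sigmaZ (q : ℤ) : PolyGWA lam eta φ :=
  ofPoly lam eta φ ((sigmaAut lam eta ^ q : k[X] ≃ₐ[k] k[X]) Polynomial.X)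

/-- The quadruple `(m₁, m₂, m₃, m₄) ∈ A⁴` is a Per `2`-cocycle, i.e. it is killed by the
differential of the total complex that computes the Hochschild cohomology of `A`. -/
def IsPerTwoCocycle (m : Fin 4 → PolyGWA lam eta φ) : Prop :=
  -(y lam eta φ * m 0) - (lam : k) • (m 1 * x lam eta φ)
      + (z lam eta φ * m 2 - m 2 * z lam eta φ) = 0 ∧
  -(((lam⁻¹ : kˣ) : k) • (m 0 * y lam eta φ)) - x lam eta φ * m 1
      + ((lam⁻¹ : kˣ) : k) • (sigmaZ lam eta φ 1 * m 3 - m 3 * sigmaZ lam eta φ 1) = 0 ∧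
  -(act lam eta φ (m 0) (delta lam eta φ (sigmaAut lam eta) AlgEquiv.refl φ))
      + (x lam eta φ * m 2 - m 3 * x lam eta φ) = 0 ∧
  -((lam : k) • act lam eta φ (m 1) (delta lam eta φ AlgEquiv.refl (sigmaAut lam eta) φ))
      + (-(m 2 * y lam eta φ) + y lam eta φ * m 3) = 0

/-- The Per `2`-cocycle `f(m) = (lam m x, -y m, 0, -lam (σΔσ)(φ) · m)`. -/
noncomputable def perF (m : PolyGWA lam eta φ) : Fin 4 → PolyGWA lam eta φ :=
  ![(lam : k) • (m * x lam eta φ), -(y lam eta φ * m), 0,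
    -((lam : k) • act lam eta φ m (delta lam eta φ (sigmaAut lam eta) (sigmaAut lam eta) φ))]

/-- The morphism of bimodules `(A ⊗ A)⁴ → A` that sends the `i`-th generator `1 ⊗ 1` to `m i`. -/
noncomputable def perEval (m : Fin 4 → PolyGWA lam eta φ)
    (t : Fin 4 → PolyGWA lam eta φ ⊗[k] PolyGWA lam eta φ) : PolyGWA lam eta φ :=
  ∑ i, act lam eta φ (m i) (t i)

/-- The value of the comparison map `θ₂` (from the bar resolution to the periodic resolution, where
it lives in `(A ⊗ A)⁴`) at `1 ⊗ z^p x^q ⊗ z^i x^j ⊗ 1`. -/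
noncomputable def thetaXX (p q i j : ℕ) :
    Fin 4 → PolyGWA lam eta φ ⊗[k] PolyGWA lam eta φ :=
  ![-∑ r ∈ Finset.range i, ∑ s ∈ Finset.range q,
      (z lam eta φ ^ p * sigmaZ lam eta φ q ^ (i - 1 - r) * x lam eta φ ^ (q - 1 - s)) ⊗ₜ[k]
        (((lam : k) • x lam eta φ) ^ s * z lam eta φ ^ r * x lam eta φ ^ j), 0, 0, 0]

/-- The value of `θ₂` at `1 ⊗ z^p x ⊗ z^i y^j ⊗ 1`, for `j ≥ 1`. -/
noncomputable def thetaXY (p i j : ℕ) :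
    Fin 4 → PolyGWA lam eta φ ⊗[k] PolyGWA lam eta φ :=
  ![-∑ r ∈ Finset.range i,
      (z lam eta φ ^ p * sigmaZ lam eta φ 1 ^ (i - 1 - r)) ⊗ₜ[k]
        (z lam eta φ ^ r * y lam eta φ ^ j), 0, 0,
    (z lam eta φ ^ p * sigmaZ lam eta φ 1 ^ i) ⊗ₜ[k] (y lam eta φ ^ (j - 1))]

/-- The value of `θ₂` at `1 ⊗ z^p y ⊗ z^i x^j ⊗ 1`, for `j ≥ 1`. -/
noncomputable def thetaYX (p i j : ℕ) :
    Fin 4 → PolyGWA lam eta φ ⊗[k] PolyGWA lam eta φ :=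
  ![0, -∑ r ∈ Finset.range i,
      (z lam eta φ ^ p * sigmaZ lam eta φ (-1) ^ (i - 1 - r)) ⊗ₜ[k]
        (z lam eta φ ^ r * x lam eta φ ^ j),
    (z lam eta φ ^ p * sigmaZ lam eta φ (-1) ^ i) ⊗ₜ[k] (x lam eta φ ^ (j - 1)), 0]

/-- The value of `θ₂` at `1 ⊗ z^p y^q ⊗ z^i y^j ⊗ 1`. -/
noncomputable def thetaYY (p q i j : ℕ) :
    Fin 4 → PolyGWA lam eta φ ⊗[k] PolyGWA lam eta φ :=
  ![0, -∑ r ∈ Finset.range i, ∑ s ∈ Finset.range q,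
      (z lam eta φ ^ p * sigmaZ lam eta φ (-q) ^ (i - 1 - r) * y lam eta φ ^ (q - 1 - s)) ⊗ₜ[k]
        ((((lam⁻¹ : kˣ) : k) • y lam eta φ) ^ s * z lam eta φ ^ r * y lam eta φ ^ j), 0, 0]

/-- `F` is the Hochschild `2`-cocycle corresponding to the Per `2`-cocycle `m`: it is a cocycle,
and `F(u, v) = m(θ₂(1 ⊗ u ⊗ v ⊗ 1))` for the pairs `(u, v)` on which `θ₂` is given above. (The
cocycle condition determines `F` on all other pairs.) -/
def CorrespondsTo (F : HochschildTwo k (PolyGWA lam eta φ)) (m : Fin 4 → PolyGWA lam eta φ) :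
    Prop :=
  IsHochschildTwoCocycle F ∧
  (∀ p q i j, F (z lam eta φ ^ p * x lam eta φ ^ q) (z lam eta φ ^ i * x lam eta φ ^ j) =
    perEval lam eta φ m (thetaXX lam eta φ p q i j)) ∧
  (∀ p i j, 1 ≤ j → F (z lam eta φ ^ p * x lam eta φ) (z lam eta φ ^ i * y lam eta φ ^ j) =
    perEval lam eta φ m (thetaXY lam eta φ p i j)) ∧
  (∀ p i j, 1 ≤ j → F (z lam eta φ ^ p * y lam eta φ) (z lam eta φ ^ i * x lam eta φ ^ j) =
    perEval lam eta φ m (thetaYX lam eta φ p i j)) ∧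
  (∀ p q i j, F (z lam eta φ ^ p * y lam eta φ ^ q) (z lam eta φ ^ i * y lam eta φ ^ j) =
    perEval lam eta φ m (thetaYY lam eta φ p q i j))

/-- Condition (b): `F(zu, v) = z F(u, v)` and `F(x^q, x^j) = F(y^q, y^j) = 0`. -/
def CondB (F : HochschildTwo k (PolyGWA lam eta φ)) : Prop :=
  (∀ u v, F (z lam eta φ * u) v = z lam eta φ * F u v) ∧
  ∀ q j : ℕ, F (x lam eta φ ^ q) (x lam eta φ ^ j) = 0 ∧ F (y lam eta φ ^ q) (y lam eta φ ^ j) = 0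

/-- `F` preserves the filtration `Γ`. -/
def PreservesGam (F : HochschildTwo k (PolyGWA lam eta φ)) : Prop :=
  ∀ p q p' q', F (basisElt lam eta φ p q) (basisElt lam eta φ p' q') ∈
    Gam lam eta φ (weight φ p q + weight φ p' q')

end Per

/-- The prescribed values of `F = F_n` on generators, where `φbar = σ(φ)`: `F(x, z) = 0`,
`F(y, z) = yz`, `F(x, y) = (-1)^n / n! z^n φbar^(n)(z)`, `F(y, x) = 0`. -/
def HasValues {k : Type*} [Field k] (lam : kˣ) (φ : k[X]) (n : ℕ)
    (F : HochschildTwo k (PolyGWA lam 0 φ)) : Prop :=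
  F (x lam 0 φ) (z lam 0 φ) = 0 ∧
  F (y lam 0 φ) (z lam 0 φ) = y lam 0 φ * z lam 0 φ ∧
  F (x lam 0 φ) (y lam 0 φ) = ((-1 : k) ^ n / (n.factorial : k)) • ofPoly lam 0 φ
    (Polynomial.X ^ n * (Polynomial.derivative^[n] (sigmaAut lam 0 φ))) ∧
  F (y lam 0 φ) (x lam 0 φ) = 0

/-- The family `F` (with `F 0` the multiplication) integrates `F₁`, its members `F_n`, `n ≥ 2`,
satisfy the conditions (a), (b), and have the prescribed values on generators. -/
def IsQuantumFamily {k : Type*} [Field k] (lam : kˣ) (φ : k[X])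
    (F₁ : HochschildTwo k (PolyGWA lam 0 φ)) (F : ℕ → HochschildTwo k (PolyGWA lam 0 φ)) : Prop :=
  Integrates F₁ F ∧
    ∀ n, 2 ≤ n → CondA (F n) ∧ CondB lam 0 φ (F n) ∧ HasValues lam φ n (F n)

end PolyGWA

/-!
Over an arbitrary commutative ring `R`, the generalized Weyl algebra `R[z; lam, 0, φ(z)]` is a free
`R`-module with basis `z ^ p x_q` (`PolyGWA.basis`). The elements span by the relations, and they
are independent because the would-be regular representation on the free module can be written down
(`GWA.rep`, `GWA.equivFinsupp`).

Apply this to `R = k⟦τ⟧` and the unit `(1 - τ) lam`. The algebra `B = k⟦τ⟧[z; (1 - τ) lam, 0, φ(z)]`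
has "the same" basis as `A = k[z; lam, 0, φ(z)]`, so that its elements can be expanded into power
series with coefficients in `A`, and its multiplication takes the form `u * v = ∑ₙ F_n(u, v) τ ^ n`
for `u, v ∈ A` (`Module.Basis.inducedCochain`, `Module.Basis.expand_mul`). This is the deformation
in question:

* Associativity of `B`, extended `τ`-adically to `A⟦τ⟧` (`starMul_assoc_of_const`), says that the
  `F_n` integrate `F_1` (`IsFormalDeformation.sum_bullet`). A product of two elements of `A`
  involves only finitely many elements of the basis of `B`, whence local finiteness, and the expansion
  identifies `B` with `Ã` (`Module.Basis.equivTilde`).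
* The products `x ^ q z ^ i = ((1 - τ) lam) ^ (q i) z ^ i x ^ q` and `x y = φ((1 - τ) lam z)` in
  `B`, expanded in powers of `τ`, yield the prescribed values of the `F_n` (`PolyGWA.hasValues_defF`,
  where the Taylor expansion of `φ((1 - τ) lam z)` produces the derivatives of `σ(φ)`) and show that
  `F_1` corresponds to the cocycle `f(z)` (`PolyGWA.correspondsTo_defF_one`).
* `Γ` is multiplicative over every ring, hence is preserved by the `F_n`
  (`PolyGWA.preservesGam_defF`).
* Localization at `τ` is the base change from `k⟦τ⟧` to `k((τ))`, and generalized Weyl algebras are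
  compatible with base change by their universal property (`PolyGWA.baseChange`).

Uniqueness follows by induction on `n`: the integrating equation prescribes the coboundary of `F_n`,
and two cochains with the same coboundary are equal if they agree when their first argument is a
generator (`HochschildTwo.ext_of_hochschildB_eq`). By (a) and (b) and the coboundary again, such
values are determined by those on `(x, z)`, `(y, z)`, `(x, y)`, `(y, x)`
(`PolyGWA.eq_of_hasValues`).
-/

/-! ### The normal form in a generalized Weyl algebra -/

namespace GWA

section Presentation

variable (R : Type*) [CommRing R] {B : Type*} [CommRing B] [Algebra R B] (σ : B ≃ₐ[R] B) (a : B)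

theorem x_mul_ofBase (b : B) : x R σ a * ofBase R σ a b = ofBase R σ a (σ b) * x R σ a := by
  have h := RingQuot.mkAlgHom_rel R (GWARel.x_base (R := R) (σ := σ) (a := a) b)
  rwa [map_mul, map_mul] at h

theorem y_mul_ofBase (b : B) :
    y R σ a * ofBase R σ a b = ofBase R σ a (σ.symm b) * y R σ a := by
  have h := RingQuot.mkAlgHom_rel R (GWARel.y_base (R := R) (σ := σ) (a := a) b)
  rwa [map_mul, map_mul] at h

theorem y_mul_x : y R σ a * x R σ a = ofBase R σ a a := by
  have h := RingQuot.mkAlgHom_rel R (GWARel.y_x (R := R) (σ := σ) (a := a))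
  rwa [map_mul] at h

theorem x_mul_y : x R σ a * y R σ a = ofBase R σ a (σ a) := by
  have h := RingQuot.mkAlgHom_rel R (GWARel.x_y (R := R) (σ := σ) (a := a))
  rwa [map_mul] at h

/-- `B(σ, a)` is generated by `B`, `x` and `y`. -/
theorem adjoin_eq_top :
    Algebra.adjoin R (Set.range (ofBase R σ a) ∪ {x R σ a, y R σ a}) = ⊤ := by
  refine eq_top_iff.2 fun g _ => ?_
  obtain ⟨w, rfl⟩ := RingQuot.mkAlgHom_surjective R (GWARel R σ a) g
  induction w using FreeAlgebra.induction with
  | grade0 r => rw [AlgHom.commutes]; exact Subalgebra.algebraMap_mem _ r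
  | grade1 t =>
    refine Algebra.subset_adjoin ?_
    cases t with
    | base b => exact Or.inl ⟨b, rfl⟩
    | x => exact Or.inr (Or.inl rfl)
    | y => exact Or.inr (Or.inr rfl)
  | mul u v hu hv => rw [map_mul]; exact mul_mem (hu trivial) (hv trivial)
  | add u v hu hv => rw [map_add]; exact add_mem (hu trivial) (hv trivial)

variable {R σ a} {C : Type*} [Ring C] [Algebra R C]

/-- The universal property of `B(σ, a)`: a morphism `f : B → C` and elements `u`, `v` of `C` that
satisfy the defining relations extend to a morphism `B(σ, a) → C`. -/
noncomputable def lift (f : B →ₐ[R] C) (u v : C) (hu : ∀ b, u * f b = f (σ b) * u)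
    (hv : ∀ b, v * f b = f (σ.symm b) * v) (hvu : v * u = f a) (huv : u * v = f (σ a)) :
    GWA R σ a →ₐ[R] C :=
  RingQuot.liftAlgHom R ⟨FreeAlgebra.lift R fun
    | .base b => f b
    | .x => u
    | .y => v, by
    intro s t h
    cases h <;> simp_all⟩

section

variable (f : B →ₐ[R] C) (u v : C) (hu : ∀ b, u * f b = f (σ b) * u)
    (hv : ∀ b, v * f b = f (σ.symm b) * v) (hvu : v * u = f a) (huv : u * v = f (σ a))

@[simp]
theorem lift_ofBase (b : B) : lift f u v hu hv hvu huv (ofBase R σ a b) = f b := by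
  change RingQuot.liftAlgHom R _ (RingQuot.mkAlgHom R _ _) = _
  rw [RingQuot.liftAlgHom_mkAlgHom_apply, FreeAlgebra.lift_ι_apply]

@[simp]
theorem lift_x : lift f u v hu hv hvu huv (x R σ a) = u := by
  rw [x, lift, RingQuot.liftAlgHom_mkAlgHom_apply, FreeAlgebra.lift_ι_apply]

@[simp]
theorem lift_y : lift f u v hu hv hvu huv (y R σ a) = v := by
  rw [y, lift, RingQuot.liftAlgHom_mkAlgHom_apply, FreeAlgebra.lift_ι_apply]

end

end Presentation

section NormalForm

variable (R : Type*) [CommRing R] {B : Type*} [CommRing B] [Algebra R B] (σ : B ≃ₐ[R] B) (a : B)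

/-- `x_q = x ^ q` for `q ≥ 0` and `x_q = y ^ (-q)` for `q < 0`. -/
noncomputable def xPow (q : ℤ) : GWA R σ a :=
  if 0 ≤ q then x R σ a ^ q.toNat else y R σ a ^ (-q).toNat

theorem xPow_natCast (n : ℕ) : xPow R σ a n = x R σ a ^ n := by simp [xPow]

theorem xPow_neg_natCast (n : ℕ) : xPow R σ a (-n) = y R σ a ^ n := by
  rcases n with _ | n
  · simp [xPow]
  · rw [xPow, if_neg (by push_cast; omega), neg_neg, Int.toNat_natCast]

theorem x_mul_xPow (q : ℤ) :
    x R σ a * xPow R σ a q = ofBase R σ a (if 0 ≤ q then 1 else σ a) * xPow R σ a (q + 1) := by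
  obtain ⟨n, rfl | rfl⟩ := q.eq_nat_or_neg
  · rw [if_pos (by omega), map_one, one_mul, ← Nat.cast_succ, xPow_natCast, xPow_natCast, pow_succ']
  · rcases n with _ | n
    · simp [xPow]
    · rw [if_neg (by push_cast; omega), xPow_neg_natCast, pow_succ', ← mul_assoc, x_mul_y,
        ← xPow_neg_natCast]
      congr 2; push_cast; ring

theorem y_mul_xPow (q : ℤ) :
    y R σ a * xPow R σ a q = ofBase R σ a (if q ≤ 0 then 1 else a) * xPow R σ a (q - 1) := by
  obtain ⟨n, rfl | rfl⟩ := q.eq_nat_or_neg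
  · rcases n with _ | n
    · simp [xPow]
    · rw [if_neg (by push_cast; omega), xPow_natCast, pow_succ', ← mul_assoc, y_mul_x,
        ← xPow_natCast]
      congr 2; push_cast; ring
  · rw [if_pos (by omega), map_one, one_mul, xPow_neg_natCast, ← pow_succ', ← xPow_neg_natCast]
    congr 1; push_cast; ring

/-- The action of `x` on the free `B`-module with basis `(v_q)_{q ∈ ℤ}`, modelled on left
multiplication by `x` on the elements `b x_q`. -/
noncomputable def xOp : (ℤ →₀ B) →ₗ[R] ℤ →₀ B :=
  Finsupp.lsum R fun q => Finsupp.lsingle (q + 1) ∘ₗ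
    LinearMap.mulRight R (if 0 ≤ q then 1 else σ a) ∘ₗ σ.toLinearMap

/-- The action of `y` on the free `B`-module with basis `(v_q)_{q ∈ ℤ}`, modelled on left
multiplication by `y` on the elements `b x_q`. -/
noncomputable def yOp : (ℤ →₀ B) →ₗ[R] ℤ →₀ B :=
  Finsupp.lsum R fun q => Finsupp.lsingle (q - 1) ∘ₗ
    LinearMap.mulRight R (if q ≤ 0 then 1 else a) ∘ₗ σ.symm.toLinearMap

theorem xOp_single (q : ℤ) (b : B) :
    xOp R σ a (.single q b) = .single (q + 1) (σ b * if 0 ≤ q then 1 else σ a) := by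
  rw [xOp, Finsupp.lsum_single]; rfl

theorem yOp_single (q : ℤ) (b : B) :
    yOp R σ a (.single q b) = .single (q - 1) (σ.symm b * if q ≤ 0 then 1 else a) := by
  rw [yOp, Finsupp.lsum_single]; rfl

/-- The representation of `B(σ, a)` on the free `B`-module with basis `(v_q)_{q ∈ ℤ}` that turns
out to be the regular one. -/
noncomputable def rep : GWA R σ a →ₐ[R] Module.End R (ℤ →₀ B) :=
  lift (Algebra.lsmul R R (ℤ →₀ B)) (xOp R σ a) (yOp R σ a)
    (fun b => by
      ext q c : 2
      simp [-Finsupp.single_mul, xOp_single, mul_assoc])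
    (fun b => by
      ext q c : 2
      simp [-Finsupp.single_mul, yOp_single, mul_assoc])
    (by
      ext q c : 2
      rcases le_or_gt 0 q with h | h
      · simp [-Finsupp.single_mul, xOp_single, yOp_single, h, show ¬ q + 1 ≤ 0 by omega, mul_comm]
      · simp [-Finsupp.single_mul, xOp_single, yOp_single, show ¬ 0 ≤ q by omega,
          show q + 1 ≤ 0 by omega, mul_comm])
    (by
      ext q c : 2
      rcases le_or_gt q 0 with h | h
      · simp [-Finsupp.single_mul, xOp_single, yOp_single, h, show ¬ 1 ≤ q by omega, mul_comm]
      · simp [-Finsupp.single_mul, xOp_single, yOp_single, show ¬ q ≤ 0 by omega,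
          show 1 ≤ q by omega, mul_comm])

/-- The map that sends `b v_q` to `b x_q`. -/
noncomputable def ofFinsupp : (ℤ →₀ B) →ₗ[R] GWA R σ a :=
  Finsupp.lsum R fun q => LinearMap.mulRight R (xPow R σ a q) ∘ₗ (ofBase R σ a).toLinearMap

theorem ofFinsupp_single (q : ℤ) (b : B) :
    ofFinsupp R σ a (.single q b) = ofBase R σ a b * xPow R σ a q := by
  rw [ofFinsupp, Finsupp.lsum_single]; rfl

theorem rep_ofBase_single (b c : B) (q : ℤ) :
    rep R σ a (ofBase R σ a b) (.single q c) = .single q (b * c) := by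
  simp [rep]

/-- The representation `rep` models left multiplication. It suffices to check this on the generators
of `B(σ, a)`. -/
theorem ofFinsupp_rep (g : GWA R σ a) (v : ℤ →₀ B) :
    ofFinsupp R σ a (rep R σ a g v) = g * ofFinsupp R σ a v := by
  have hg : g ∈ Algebra.adjoin R (Set.range (ofBase R σ a) ∪ {x R σ a, y R σ a}) := by
    rw [adjoin_eq_top]; trivial
  induction hg using Algebra.adjoin_induction generalizing v with
  | mem g hg =>
    induction v using Finsupp.induction_linear with
    | zero => simp
    | add v w hv hw => simp only [map_add, hv, hw, mul_add]
    | single q c =>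
      obtain ⟨b, rfl⟩ | rfl | rfl := hg
      · rw [rep_ofBase_single, ofFinsupp_single, ofFinsupp_single, map_mul, mul_assoc]
      · rw [rep, lift_x, xOp_single, ofFinsupp_single, ofFinsupp_single, ← mul_assoc,
          x_mul_ofBase, mul_assoc, x_mul_xPow, map_mul, mul_assoc]
      · rw [rep, lift_y, yOp_single, ofFinsupp_single, ofFinsupp_single, ← mul_assoc,
          y_mul_ofBase, mul_assoc, y_mul_xPow, map_mul, mul_assoc]
  | algebraMap r => rw [AlgHom.commutes, Module.algebraMap_end_apply, map_smul, Algebra.smul_def]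
  | add g h _ _ hg hh => rw [map_add, LinearMap.add_apply, map_add, hg, hh, add_mul]
  | mul g h _ _ hg hh => rw [map_mul, Module.End.mul_apply, hg, hh, mul_assoc]

theorem rep_xPow_single_zero (q : ℤ) : rep R σ a (xPow R σ a q) (.single 0 1) = .single q 1 := by
  obtain ⟨n, rfl | rfl⟩ := q.eq_nat_or_neg
  · rw [xPow_natCast, map_pow]
    induction n with
    | zero => simp
    | succ n ih => rw [pow_succ', Module.End.mul_apply, ih, rep, lift_x, xOp_single]; simp
  · rw [xPow_neg_natCast, map_pow]
    induction n with
    | zero => simp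
    | succ n ih =>
      rw [pow_succ', Module.End.mul_apply, ih, rep, lift_y, yOp_single, if_pos (by omega)]
      simp only [map_one, mul_one]
      congr 1; push_cast; ring

/-- The normal form: every element of `B(σ, a)` is in exactly one way a sum of elements
`b x_q`. The coefficients of such a sum `g` are read off from the action of `g` on `v_0`, since
`x_q` sends `v_0` to `v_q`. -/
noncomputable def equivFinsupp : (ℤ →₀ B) ≃ₗ[R] GWA R σ a :=
  LinearEquiv.ofLinearMap (ofFinsupp R σ a)
    (LinearMap.applyₗ (Finsupp.single 0 1) ∘ₗ (rep R σ a).toLinearMap)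
    (by
      ext g
      simp [ofFinsupp_rep, ofFinsupp_single, xPow])
    (by
      ext q b : 2
      simp [ofFinsupp_single, rep_xPow_single_zero, rep_ofBase_single])

end NormalForm

end GWA

namespace PolyGWA

section

variable {R : Type*} [CommRing R] (lam : Rˣ) (φ : R[X])

/-- The basis of `R[z; lam, 0, φ(z)]` that consists of the elements `z ^ p x_q`. -/
noncomputable def basis : Module.Basis (ℕ × ℤ) R (PolyGWA lam 0 φ) :=
  ((Finsupp.basis fun _ : ℤ => Polynomial.basisMonomials R).map
    (GWA.equivFinsupp R (sigmaAut lam 0) φ)).reindex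
      ((Equiv.sigmaEquivProd ℤ ℕ).trans (Equiv.prodComm ℤ ℕ))

end

end PolyGWA

/-! ### Relations and monomials in `R[z; lam, 0, φ(z)]` -/

theorem pow_mul_pow_of_mul_eq_smul {R C : Type*} [CommRing R] [Ring C] [Algebra R C] {Z W : C}
    {c : R} (h : W * Z = c • (Z * W)) (m n : ℕ) :
    W ^ m * Z ^ n = c ^ (m * n) • (Z ^ n * W ^ m) := by
  have h1 : ∀ n, W * Z ^ n = c ^ n • (Z ^ n * W) := by
    intro n
    induction n with
    | zero => simp
    | succ n ih =>
      rw [pow_succ Z, ← mul_assoc, ih, smul_mul_assoc, mul_assoc, h, mul_smul_comm, smul_smul,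
        ← pow_succ, mul_assoc]
  induction m with
  | zero => simp
  | succ m ih =>
    rw [pow_succ, mul_assoc, h1, mul_smul_comm, ← mul_assoc, ih, smul_mul_assoc, smul_smul,
      mul_assoc, ← pow_add, add_mul, one_mul, add_comm n]

namespace PolyGWA

section

variable {R : Type*} [CommRing R] (lam : Rˣ) (φ : R[X])

theorem ofPoly_eq_aeval (h : R[X]) : ofPoly lam 0 φ h = Polynomial.aeval (z lam 0 φ) h := by
  have : GWA.ofBase R (sigmaAut lam 0) φ = Polynomial.aeval (z lam 0 φ) := by
    ext; simp [z, ofPoly]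
  rw [ofPoly, this]

@[simp]
theorem ofPoly_one : ofPoly lam 0 φ 1 = 1 := map_one _

@[simp]
theorem ofPoly_add (g h : R[X]) : ofPoly lam 0 φ (g + h) = ofPoly lam 0 φ g + ofPoly lam 0 φ h :=
  map_add _ _ _

@[simp]
theorem ofPoly_mul (g h : R[X]) : ofPoly lam 0 φ (g * h) = ofPoly lam 0 φ g * ofPoly lam 0 φ h :=
  map_mul _ _ _

@[simp]
theorem ofPoly_smul (c : R) (h : R[X]) : ofPoly lam 0 φ (c • h) = c • ofPoly lam 0 φ h :=
  map_smul (GWA.ofBase R (sigmaAut lam 0) φ) _ _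

@[simp]
theorem ofPoly_X_pow (n : ℕ) : ofPoly lam 0 φ (Polynomial.X ^ n) = z lam 0 φ ^ n := map_pow _ _ _

@[simp]
theorem ofPoly_monomial (n : ℕ) (c : R) :
    ofPoly lam 0 φ (Polynomial.monomial n c) = c • z lam 0 φ ^ n := by
  rw [← Polynomial.smul_X_eq_monomial, ofPoly_smul, ofPoly_X_pow]

theorem sigmaAut_apply (h : R[X]) :
    sigmaAut lam 0 h = h.comp (Polynomial.C (lam : R) * Polynomial.X) := by
  simp [sigmaAut, Polynomial.comp, Polynomial.aeval_def]

theorem sigmaAut_symm_apply (h : R[X]) : (sigmaAut lam 0).symm h =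
    h.comp (Polynomial.C ((lam⁻¹ : Rˣ) : R) * Polynomial.X) := by
  simp [sigmaAut, Polynomial.comp, Polynomial.aeval_def]

theorem sigmaAut_X_pow (n : ℕ) :
    sigmaAut lam 0 (Polynomial.X ^ n) = (lam : R) ^ n • Polynomial.X ^ n := by
  simp [sigmaAut_apply, mul_pow, Polynomial.smul_eq_C_mul]

theorem sigmaAut_monomial (n : ℕ) (c : R) : sigmaAut lam 0 (Polynomial.monomial n c) =
    Polynomial.monomial n (c * (lam : R) ^ n) := by
  rw [← Polynomial.smul_X_eq_monomial, map_smul, sigmaAut_X_pow, smul_smul,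
    Polynomial.smul_X_eq_monomial]

theorem sigmaAut_symm_X_pow (n : ℕ) : (sigmaAut lam 0).symm (Polynomial.X ^ n) =
    ((lam⁻¹ : Rˣ) : R) ^ n • Polynomial.X ^ n := by
  simp [sigmaAut_symm_apply, mul_pow, Polynomial.smul_eq_C_mul]

theorem xPow_natCast (n : ℕ) : xPow lam 0 φ n = x lam 0 φ ^ n := GWA.xPow_natCast ..

theorem xPow_neg_natCast (n : ℕ) : xPow lam 0 φ (-n) = y lam 0 φ ^ n := GWA.xPow_neg_natCast ..

@[simp]
theorem xPow_zero : xPow lam 0 φ 0 = 1 := by simp [xPow]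

theorem basis_apply (p : ℕ) (q : ℤ) : basis lam φ (p, q) = basisElt lam 0 φ p q := by
  have h : basis lam φ (p, q) =
      GWA.ofFinsupp R (sigmaAut lam 0) φ (.single q (Polynomial.X ^ p)) := by
    simp [basis, GWA.equivFinsupp, Polynomial.X_pow_eq_monomial]
  rw [h, GWA.ofFinsupp_single]
  exact congrArg (· * _) (ofPoly_X_pow lam φ p)

theorem y_mul_x : y lam 0 φ * x lam 0 φ = ofPoly lam 0 φ φ := GWA.y_mul_x ..

theorem x_mul_y : x lam 0 φ * y lam 0 φ = ofPoly lam 0 φ (sigmaAut lam 0 φ) := GWA.x_mul_y ..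

theorem x_mul_z : x lam 0 φ * z lam 0 φ = (lam : R) • (z lam 0 φ * x lam 0 φ) := by
  have h := GWA.x_mul_ofBase R (sigmaAut lam 0) φ (Polynomial.X ^ 1)
  rw [sigmaAut_X_pow, map_smul, smul_mul_assoc, pow_one, pow_one] at h
  exact h

theorem y_mul_z : y lam 0 φ * z lam 0 φ = ((lam⁻¹ : Rˣ) : R) • (z lam 0 φ * y lam 0 φ) := by
  have h := GWA.y_mul_ofBase R (sigmaAut lam 0) φ (Polynomial.X ^ 1)
  rw [sigmaAut_symm_X_pow, map_smul, smul_mul_assoc, pow_one, pow_one] at h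
  exact h

theorem x_pow_mul_z_pow (m n : ℕ) : x lam 0 φ ^ m * z lam 0 φ ^ n =
    (lam : R) ^ (m * n) • (z lam 0 φ ^ n * x lam 0 φ ^ m) :=
  pow_mul_pow_of_mul_eq_smul (x_mul_z lam φ) m n

theorem y_pow_mul_z_pow (m n : ℕ) : y lam 0 φ ^ m * z lam 0 φ ^ n =
    ((lam⁻¹ : Rˣ) : R) ^ (m * n) • (z lam 0 φ ^ n * y lam 0 φ ^ m) :=
  pow_mul_pow_of_mul_eq_smul (y_mul_z lam φ) m n

theorem x_mul_z_pow (n : ℕ) :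
    x lam 0 φ * z lam 0 φ ^ n = (lam : R) ^ n • (z lam 0 φ ^ n * x lam 0 φ) := by
  simpa using x_pow_mul_z_pow lam φ 1 n

theorem y_mul_z_pow (n : ℕ) :
    y lam 0 φ * z lam 0 φ ^ n = ((lam⁻¹ : Rˣ) : R) ^ n • (z lam 0 φ ^ n * y lam 0 φ) := by
  simpa using y_pow_mul_z_pow lam φ 1 n

theorem x_mul_basisElt (p : ℕ) (q : ℤ) : x lam 0 φ * basisElt lam 0 φ p q = (lam : R) ^ p •
    (z lam 0 φ ^ p * (ofPoly lam 0 φ (if 0 ≤ q then 1 else sigmaAut lam 0 φ) *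
      xPow lam 0 φ (q + 1))) := by
  rw [basisElt, ← mul_assoc, x_mul_z_pow, smul_mul_assoc, mul_assoc]
  exact congrArg (fun t => _ • (_ * t)) (GWA.x_mul_xPow ..)

theorem y_mul_basisElt (p : ℕ) (q : ℤ) : y lam 0 φ * basisElt lam 0 φ p q =
    ((lam⁻¹ : Rˣ) : R) ^ p • (z lam 0 φ ^ p * (ofPoly lam 0 φ (if q ≤ 0 then 1 else φ) *
      xPow lam 0 φ (q - 1))) := by
  rw [basisElt, ← mul_assoc, y_mul_z_pow, smul_mul_assoc, mul_assoc]
  exact congrArg (fun t => _ • (_ * t)) (GWA.y_mul_xPow ..)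

theorem adjoin_generators :
    Algebra.adjoin R {z lam 0 φ, x lam 0 φ, y lam 0 φ} = ⊤ := by
  rw [eq_top_iff, ← GWA.adjoin_eq_top R (sigmaAut lam 0) φ, Algebra.adjoin_le_iff]
  rintro _ (⟨h, rfl⟩ | rfl | rfl)
  · change ofPoly lam 0 φ h ∈ _
    rw [ofPoly_eq_aeval]
    exact Algebra.adjoin_mono (by simp) (Polynomial.aeval_mem_adjoin_singleton R _)
  · exact Algebra.subset_adjoin (.inr (.inl rfl))
  · exact Algebra.subset_adjoin (.inr (.inr rfl))

theorem linearMap_ext_basisElt {M : Type*} [AddCommGroup M] [Module R M]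
    {f g : PolyGWA lam 0 φ →ₗ[R] M}
    (hx : ∀ p q : ℕ, f (z lam 0 φ ^ p * x lam 0 φ ^ q) = g (z lam 0 φ ^ p * x lam 0 φ ^ q))
    (hy : ∀ p q : ℕ, 1 ≤ q →
      f (z lam 0 φ ^ p * y lam 0 φ ^ q) = g (z lam 0 φ ^ p * y lam 0 φ ^ q)) :
    f = g := by
  refine (basis lam φ).ext fun ⟨p, q⟩ => ?_
  rw [basis_apply, basisElt]
  obtain ⟨n, rfl | rfl⟩ := q.eq_nat_or_neg
  · rw [xPow_natCast, hx]
  · rcases n with _ | n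
    · simpa using hx p 0
    · rw [xPow_neg_natCast, hy _ _ (by omega)]

/-! ### The filtration -/

theorem Gam_mono {m n : ℕ} (h : m ≤ n) : Gam lam 0 φ m ≤ Gam lam 0 φ n :=
  Submodule.span_mono fun _ ⟨p, q, hw, hb⟩ => ⟨p, q, hw.trans h, hb⟩

theorem z_pow_mul_mem_Gam (m : ℕ) {n : ℕ} {u : PolyGWA lam 0 φ} (hu : u ∈ Gam lam 0 φ n) :
    z lam 0 φ ^ m * u ∈ Gam lam 0 φ (m + n) := by
  induction hu using Submodule.span_induction with
  | mem u hu =>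
    obtain ⟨p, q, hw, rfl⟩ := hu
    refine Submodule.subset_span ⟨m + p, q, ?_, ?_⟩
    · simp only [weight] at hw ⊢; omega
    · rw [basisElt, basisElt, pow_add, mul_assoc]
  | zero => simp
  | add u v _ _ hu hv => rw [mul_add]; exact add_mem hu hv
  | smul c u _ hu => rw [mul_smul_comm]; exact Submodule.smul_mem _ _ hu

theorem ofPoly_mul_xPow_mem_Gam (h : R[X]) (q : ℤ) : ofPoly lam 0 φ h * xPow lam 0 φ q ∈
    Gam lam 0 φ (h.natDegree + (φ.natDegree + 1) * q.natAbs) := by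
  rw [ofPoly_eq_aeval, Polynomial.aeval_eq_sum_range, Finset.sum_mul]
  refine sum_mem fun i hi => ?_
  rw [smul_mul_assoc]
  refine Submodule.smul_mem _ _ (Submodule.subset_span ⟨i, q, ?_, rfl⟩)
  simp only [weight]
  have := Finset.mem_range.1 hi
  omega

theorem natDegree_sigmaAut_le (h : R[X]) : (sigmaAut lam 0 h).natDegree ≤ h.natDegree := by
  rw [sigmaAut_apply]
  refine Polynomial.natDegree_comp_le.trans ?_
  calc _ ≤ h.natDegree * 1 := Nat.mul_le_mul_left _ ((Polynomial.natDegree_C_mul_le _ _).trans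
        Polynomial.natDegree_X_le)
    _ = _ := mul_one _

theorem x_mul_mem_Gam {n : ℕ} {u : PolyGWA lam 0 φ} (hu : u ∈ Gam lam 0 φ n) :
    x lam 0 φ * u ∈ Gam lam 0 φ (φ.natDegree + 1 + n) := by
  induction hu using Submodule.span_induction with
  | mem u hu =>
    obtain ⟨p, q, hw, rfl⟩ := hu
    rw [x_mul_basisElt]
    refine Submodule.smul_mem _ _
      (Gam_mono _ _ ?_ (z_pow_mul_mem_Gam lam φ p (ofPoly_mul_xPow_mem_Gam lam φ _ _)))
    simp only [weight] at hw
    split_ifs with h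
    · rw [show (q + 1).natAbs = q.natAbs + 1 by omega, Polynomial.natDegree_one]
      linarith
    · have h1 := natDegree_sigmaAut_le lam φ
      rw [show q.natAbs = (q + 1).natAbs + 1 by omega] at hw
      linarith
  | zero => simp
  | add u v _ _ hu hv => rw [mul_add]; exact add_mem hu hv
  | smul c u _ hu => rw [mul_smul_comm]; exact Submodule.smul_mem _ _ hu

theorem y_mul_mem_Gam {n : ℕ} {u : PolyGWA lam 0 φ} (hu : u ∈ Gam lam 0 φ n) :
    y lam 0 φ * u ∈ Gam lam 0 φ (φ.natDegree + 1 + n) := by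
  induction hu using Submodule.span_induction with
  | mem u hu =>
    obtain ⟨p, q, hw, rfl⟩ := hu
    rw [y_mul_basisElt]
    refine Submodule.smul_mem _ _
      (Gam_mono _ _ ?_ (z_pow_mul_mem_Gam lam φ p (ofPoly_mul_xPow_mem_Gam lam φ _ _)))
    simp only [weight] at hw
    split_ifs with h
    · rw [show (q - 1).natAbs = q.natAbs + 1 by omega, Polynomial.natDegree_one]
      linarith
    · rw [show q.natAbs = (q - 1).natAbs + 1 by omega] at hw
      linarith
  | zero => simp
  | add u v _ _ hu hv => rw [mul_add]; exact add_mem hu hv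
  | smul c u _ hu => rw [mul_smul_comm]; exact Submodule.smul_mem _ _ hu

theorem basisElt_mul_mem_Gam (p : ℕ) (q : ℤ) {n : ℕ} {u : PolyGWA lam 0 φ}
    (hu : u ∈ Gam lam 0 φ n) : basisElt lam 0 φ p q * u ∈ Gam lam 0 φ (weight φ p q + n) := by
  have hpow : ∀ (w : PolyGWA lam 0 φ) (m : ℕ),
      (∀ {n : ℕ} {u : PolyGWA lam 0 φ}, u ∈ Gam lam 0 φ n →
        w * u ∈ Gam lam 0 φ (φ.natDegree + 1 + n)) →
      w ^ m * u ∈ Gam lam 0 φ ((φ.natDegree + 1) * m + n) := by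
    intro w m hw
    induction m with
    | zero => simpa using hu
    | succ m ih =>
      rw [pow_succ', mul_assoc]
      convert! hw ih using 2
      ring
  rw [basisElt, mul_assoc, weight, add_assoc]
  refine z_pow_mul_mem_Gam _ _ _ ?_
  obtain ⟨m, rfl | rfl⟩ := q.eq_nat_or_neg
  · rw [xPow_natCast, Int.natAbs_natCast]
    exact hpow _ _ (x_mul_mem_Gam lam φ)
  · rw [xPow_neg_natCast, Int.natAbs_neg, Int.natAbs_natCast]
    exact hpow _ _ (y_mul_mem_Gam lam φ)

/-- The filtration `Γ` is multiplicative. -/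
theorem basisElt_mul_basisElt_mem_Gam (p p' : ℕ) (q q' : ℤ) :
    basisElt lam 0 φ p q * basisElt lam 0 φ p' q' ∈
      Gam lam 0 φ (weight φ p q + weight φ p' q') :=
  basisElt_mul_mem_Gam lam φ p q (Submodule.subset_span ⟨p', q', le_rfl, rfl⟩)

end

/-! ### Universal property and base change -/

section Lift

variable {R : Type*} [CommRing R] {lam : Rˣ} {φ : R[X]} {C : Type*} [Ring C] [Algebra R C]

theorem mul_aeval_of_mul_eq_smul {Z W : C} {c : R} (h : W * Z = c • (Z * W)) (b : R[X]) :
    W * Polynomial.aeval Z b =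
      Polynomial.aeval Z (b.comp (Polynomial.C c * Polynomial.X)) * W := by
  induction b using Polynomial.induction_on' with
  | add p q hp hq => simp only [map_add, Polynomial.add_comp, mul_add, add_mul, hp, hq]
  | monomial n r =>
    have hn : W * Z ^ n = c ^ n • (Z ^ n * W) := by
      simpa using pow_mul_pow_of_mul_eq_smul h 1 n
    rw [← Polynomial.smul_X_eq_monomial, Polynomial.smul_comp, Polynomial.X_pow_comp, mul_pow,
      ← Polynomial.C_pow, ← Polynomial.smul_eq_C_mul, map_smul, map_smul, map_smul, map_pow,
      Polynomial.aeval_X, mul_smul_comm, hn, smul_mul_assoc, smul_mul_assoc]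

/-- The universal property of `R[z; lam, 0, φ(z)]`. -/
noncomputable def lift (Z U V : C) (hUZ : U * Z = (lam : R) • (Z * U))
    (hVZ : V * Z = ((lam⁻¹ : Rˣ) : R) • (Z * V)) (hVU : V * U = Polynomial.aeval Z φ)
    (hUV : U * V = Polynomial.aeval ((lam : R) • Z) φ) : PolyGWA lam 0 φ →ₐ[R] C :=
  GWA.lift (Polynomial.aeval Z) U V
    (fun b => by rw [sigmaAut_apply]; exact mul_aeval_of_mul_eq_smul hUZ b)
    (fun b => by rw [sigmaAut_symm_apply]; exact mul_aeval_of_mul_eq_smul hVZ b) hVU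
    (by rw [hUV, sigmaAut_apply, Polynomial.aeval_comp]; simp [Algebra.smul_def])

section

variable (Z U V : C) (hUZ : U * Z = (lam : R) • (Z * U))
    (hVZ : V * Z = ((lam⁻¹ : Rˣ) : R) • (Z * V)) (hVU : V * U = Polynomial.aeval Z φ)
    (hUV : U * V = Polynomial.aeval ((lam : R) • Z) φ)

@[simp]
theorem lift_z : lift Z U V hUZ hVZ hVU hUV (z lam 0 φ) = Z := by
  rw [lift, z, ofPoly, GWA.lift_ofBase, Polynomial.aeval_X]

@[simp]
theorem lift_x : lift Z U V hUZ hVZ hVU hUV (x lam 0 φ) = U := GWA.lift_x _ _ _ _ _ _ _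

@[simp]
theorem lift_y : lift Z U V hUZ hVZ hVU hUV (y lam 0 φ) = V := GWA.lift_y _ _ _ _ _ _ _

end

theorem algHom_ext {f g : PolyGWA lam 0 φ →ₐ[R] C} (hz : f (z lam 0 φ) = g (z lam 0 φ))
    (hx : f (x lam 0 φ) = g (x lam 0 φ)) (hy : f (y lam 0 φ) = g (y lam 0 φ)) : f = g :=
  AlgHom.ext_of_adjoin_eq_top (adjoin_generators lam φ) <| by
    rintro _ (rfl | rfl | rfl) <;> assumption

theorem x_mul_y_eq_aeval :
    x lam 0 φ * y lam 0 φ = Polynomial.aeval ((lam : R) • z lam 0 φ) φ := by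
  rw [x_mul_y, ofPoly_eq_aeval, sigmaAut_apply, Polynomial.aeval_comp]
  simp [Algebra.smul_def]

end Lift

section BaseChange

variable {R K : Type*} [CommRing R] [CommRing K] [Algebra R K] {lam : Rˣ} {φ : R[X]}
  {lam' : Kˣ} {φ' : K[X]}

section

variable (hlam : (lam' : K) = algebraMap R K lam) (hφ : φ' = φ.map (algebraMap R K))

theorem val_inv_of_val_eq (hlam : (lam' : K) = algebraMap R K lam) :
    ((lam'⁻¹ : Kˣ) : K) = algebraMap R K ((lam⁻¹ : Rˣ) : R) := by
  have hunit : lam' = Units.map (algebraMap R K).toMonoidHom lam := Units.ext hlam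
  rw [hunit, ← map_inv]; rfl

/-- The morphism `R[z; lam, 0, φ(z)] → K[z; lam, 0, φ(z)]`, for an `R`-algebra `K`. -/
noncomputable def mapBase : PolyGWA lam 0 φ →ₐ[R] PolyGWA lam' 0 φ' :=
  lift (z lam' 0 φ') (x lam' 0 φ') (y lam' 0 φ')
    (by rw [x_mul_z, hlam, algebraMap_smul])
    (by rw [y_mul_z, val_inv_of_val_eq hlam, algebraMap_smul])
    (by rw [y_mul_x, ofPoly_eq_aeval, hφ, Polynomial.aeval_map_algebraMap])
    (by rw [x_mul_y_eq_aeval, hlam, algebraMap_smul, hφ, Polynomial.aeval_map_algebraMap])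

/-- The morphism `K ⊗ R[z; lam, 0, φ(z)] → K[z; lam, 0, φ(z)]`. -/
noncomputable def ofTensor : K ⊗[R] PolyGWA lam 0 φ →ₐ[K] PolyGWA lam' 0 φ' :=
  Algebra.TensorProduct.lift (Algebra.ofId K _) (mapBase hlam hφ) (fun c _ => Algebra.commutes c _)

theorem ofTensor_one_tmul (u : PolyGWA lam 0 φ) :
    ofTensor hlam hφ (1 ⊗ₜ u) = mapBase hlam hφ u :=
  (Algebra.TensorProduct.lift_tmul _ _ _ _ _).trans (by rw [map_one, one_mul])

/-- The morphism `K[z; lam, 0, φ(z)] → K ⊗ R[z; lam, 0, φ(z)]`. -/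
noncomputable def toTensor : PolyGWA lam' 0 φ' →ₐ[K] K ⊗[R] PolyGWA lam 0 φ :=
  lift (1 ⊗ₜ z lam 0 φ) (1 ⊗ₜ x lam 0 φ) (1 ⊗ₜ y lam 0 φ)
    (by rw [Algebra.TensorProduct.tmul_mul_tmul, Algebra.TensorProduct.tmul_mul_tmul, x_mul_z,
      hlam, algebraMap_smul, TensorProduct.tmul_smul])
    (by rw [Algebra.TensorProduct.tmul_mul_tmul, Algebra.TensorProduct.tmul_mul_tmul, y_mul_z,
      val_inv_of_val_eq hlam, algebraMap_smul, TensorProduct.tmul_smul])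
    (by
      rw [Algebra.TensorProduct.tmul_mul_tmul, y_mul_x, mul_one, ofPoly_eq_aeval, hφ,
        Polynomial.aeval_map_algebraMap, ← Algebra.TensorProduct.includeRight_apply,
        ← Algebra.TensorProduct.includeRight_apply, Polynomial.aeval_algHom_apply])
    (by
      rw [Algebra.TensorProduct.tmul_mul_tmul, x_mul_y_eq_aeval, mul_one, hφ, hlam,
        algebraMap_smul, Polynomial.aeval_map_algebraMap, ← TensorProduct.tmul_smul,
        ← Algebra.TensorProduct.includeRight_apply,
        ← Algebra.TensorProduct.includeRight_apply, Polynomial.aeval_algHom_apply])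

/-- Generalized Weyl algebras are compatible with extension of scalars. -/
noncomputable def baseChange : K ⊗[R] PolyGWA lam 0 φ ≃ₐ[K] PolyGWA lam' 0 φ' :=
  AlgEquiv.ofAlgHom (ofTensor hlam hφ) (toTensor hlam hφ)
    (by apply algHom_ext <;> simp [toTensor, ofTensor_one_tmul, mapBase])
    (by
      refine Algebra.TensorProduct.ext' fun c u => ?_
      have key : ((toTensor hlam hφ).restrictScalars R).comp (mapBase hlam hφ) =
          Algebra.TensorProduct.includeRight := by
        apply algHom_ext <;> simp [toTensor, mapBase]
      have hu := AlgHom.congr_fun key u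
      have hc : c ⊗ₜ[R] u = c • (1 ⊗ₜ[R] u) := by
        rw [TensorProduct.smul_tmul', smul_eq_mul, mul_one]
      rw [hc, map_smul, map_smul, AlgHom.comp_apply, ofTensor_one_tmul]
      exact congrArg (c • ·) hu)

theorem baseChange_z : baseChange hlam hφ (1 ⊗ₜ z lam 0 φ) = z lam' 0 φ' :=
  (ofTensor_one_tmul hlam hφ _).trans (by simp [mapBase])

theorem baseChange_x : baseChange hlam hφ (1 ⊗ₜ x lam 0 φ) = x lam' 0 φ' :=
  (ofTensor_one_tmul hlam hφ _).trans (by simp [mapBase])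

theorem baseChange_y : baseChange hlam hφ (1 ⊗ₜ y lam 0 φ) = y lam' 0 φ' :=
  (ofTensor_one_tmul hlam hφ _).trans (by simp [mapBase])

end

end BaseChange

end PolyGWA

/-! ### Star products on `A⟦X⟧` -/

section StarMul

variable {k A : Type*} [CommRing k] [Ring A] [Algebra k A] (F : ℕ → HochschildTwo k A)

theorem starMul_zero_left (v : A⟦X⟧) : starMul F 0 v = 0 := by
  have h := starMul_add_left F 0 0 v
  rw [add_zero] at h
  exact left_eq_add.mp h

theorem starMul_zero_right (u : A⟦X⟧) : starMul F u 0 = 0 := by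
  have h := starMul_add_right F u 0 0
  rw [add_zero] at h
  exact left_eq_add.mp h

theorem coeff_starMul_C_right (u : A⟦X⟧) (c : A) (n : ℕ) :
    PowerSeries.coeff n (starMul F u (PowerSeries.C c)) =
      ∑ p ∈ Finset.HasAntidiagonal.antidiagonal n, F p.1 (PowerSeries.coeff p.2 u) c := by
  rw [starMul, PowerSeries.coeff_mk]
  refine Finset.sum_congr rfl fun p _ => ?_
  rw [Finset.sum_eq_single (p.2, 0)]
  · simp
  · rintro ⟨i, j⟩ h hne
    have hj : j ≠ 0 := by
      rintro rfl
      simp only [Finset.HasAntidiagonal.mem_antidiagonal, add_zero] at h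
      exact hne (by rw [h])
    simp [PowerSeries.coeff_C, hj]
  · simp

theorem coeff_starMul_C_left (a : A) (v : A⟦X⟧) (n : ℕ) :
    PowerSeries.coeff n (starMul F (PowerSeries.C a) v) =
      ∑ p ∈ Finset.HasAntidiagonal.antidiagonal n, F p.1 a (PowerSeries.coeff p.2 v) := by
  rw [starMul, PowerSeries.coeff_mk]
  refine Finset.sum_congr rfl fun p _ => ?_
  rw [Finset.sum_eq_single (0, p.2)]
  · simp
  · rintro ⟨i, j⟩ h hne
    have hi : i ≠ 0 := by
      rintro rfl
      simp only [Finset.HasAntidiagonal.mem_antidiagonal, zero_add] at h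
      exact hne (by rw [h])
    simp [PowerSeries.coeff_C, hi]
  · simp

theorem starMul_C_C (a b : A) : starMul F (PowerSeries.C a) (PowerSeries.C b) =
    PowerSeries.mk fun n => F n a b := by
  ext n
  rw [coeff_starMul_C_right, PowerSeries.coeff_mk, Finset.sum_eq_single (n, 0)]
  · simp
  · rintro ⟨i, j⟩ h hne
    have hj : j ≠ 0 := by
      rintro rfl
      simp only [Finset.HasAntidiagonal.mem_antidiagonal, add_zero] at h
      exact hne (by rw [h])
    simp [PowerSeries.coeff_C, hj]
  · simp

theorem coeff_starMul_congr {u u' v v' : A⟦X⟧} {n : ℕ}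
    (hu : ∀ m ≤ n, PowerSeries.coeff m u = PowerSeries.coeff m u')
    (hv : ∀ m ≤ n, PowerSeries.coeff m v = PowerSeries.coeff m v') :
    ∀ m ≤ n, PowerSeries.coeff m (starMul F u v) = PowerSeries.coeff m (starMul F u' v') := by
  intro m hm
  simp only [starMul, PowerSeries.coeff_mk]
  refine Finset.sum_congr rfl fun p hp => Finset.sum_congr rfl fun q hq => ?_
  rw [Finset.HasAntidiagonal.mem_antidiagonal] at hp hq
  rw [hu q.1 (by omega), hv q.2 (by omega)]

/-- A star product is associative if it is associative on constants. By continuity in the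
`τ`-adic topology only series with finitely many terms matter, and these are reached by
`k⟦X⟧`-linearity. -/
theorem starMul_assoc_of_const
    (h : ∀ a b c, starMul F (starMul F (PowerSeries.C a) (PowerSeries.C b)) (PowerSeries.C c) =
      starMul F (PowerSeries.C a) (starMul F (PowerSeries.C b) (PowerSeries.C c)))
    (u v w : A⟦X⟧) : starMul F (starMul F u v) w = starMul F u (starMul F v w) := by
  let S : AddSubmonoid A⟦X⟧ :=
    AddSubmonoid.closure {s | ∃ (c : k⟦X⟧) (a : A), s = scal c (PowerSeries.C a)}
  have hS : ∀ u ∈ S, ∀ v ∈ S, ∀ w ∈ S,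
      starMul F (starMul F u v) w = starMul F u (starMul F v w) := by
    intro u hu v hv w hw
    induction hu using AddSubmonoid.closure_induction with
    | zero => simp only [starMul_zero_left]
    | add _ _ _ _ h₁ h₂ => simp only [starMul_add_left, h₁, h₂]
    | mem u hu =>
      induction hv using AddSubmonoid.closure_induction with
      | zero => simp only [starMul_zero_left, starMul_zero_right]
      | add _ _ _ _ h₁ h₂ => simp only [starMul_add_left, starMul_add_right, h₁, h₂]
      | mem v hv =>
        induction hw using AddSubmonoid.closure_induction with
        | zero => simp only [starMul_zero_right]
        | add _ _ _ _ h₁ h₂ => simp only [starMul_add_right, h₁, h₂]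
        | mem w hw =>
          obtain ⟨c₁, a₁, rfl⟩ := hu
          obtain ⟨c₂, a₂, rfl⟩ := hv
          obtain ⟨c₃, a₃, rfl⟩ := hw
          simp only [starMul_scal_left, starMul_scal_right, h]
  -- Coefficients up to `τ ^ n` are not changed by truncation, and truncated series lie in `S`.
  have happrox : ∀ (n : ℕ) (u : A⟦X⟧), ∃ u' ∈ S,
      ∀ m ≤ n, PowerSeries.coeff m u = PowerSeries.coeff m u' := by
    intro n u
    refine ⟨∑ i ∈ Finset.range (n + 1), scal (PowerSeries.X ^ i : k⟦X⟧)
      (PowerSeries.C (PowerSeries.coeff i u)),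
      sum_mem fun i _ => AddSubmonoid.subset_closure ⟨_, _, rfl⟩, fun m hm => ?_⟩
    rw [map_sum, Finset.sum_eq_single m]
    · simp [scal]
    · intro i _ hi
      simp only [scal, map_pow, PowerSeries.map_X, PowerSeries.coeff_X_pow_mul',
        PowerSeries.coeff_C]
      split_ifs <;> first | rfl | omega
    · intro hm'
      exact absurd (Finset.mem_range.2 (by omega)) hm'
  ext n
  obtain ⟨u', hu', hu⟩ := happrox n u
  obtain ⟨v', hv', hv⟩ := happrox n v
  obtain ⟨w', hw', hw⟩ := happrox n w
  rw [coeff_starMul_congr F (coeff_starMul_congr F hu hv) hw n le_rfl,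
    coeff_starMul_congr F hu (coeff_starMul_congr F hv hw) n le_rfl, hS u' hu' v' hv' w' hw']

variable {F}

/-- The coefficient of `τ ^ n` in the associativity of a formal deformation, on constants. -/
theorem IsFormalDeformation.sum_bullet (hF : IsFormalDeformation F) {n : ℕ} (hn : 1 ≤ n)
    (a b c : A) : ∑ i ∈ Finset.Icc 1 (n - 1), bullet (F i) (F (n - i)) a b c =
      hochschildB (F n) a b c := by
  have h := congrArg (PowerSeries.coeff n)
    (hF.2 (PowerSeries.C a) (PowerSeries.C b) (PowerSeries.C c))
  rw [coeff_starMul_C_right, coeff_starMul_C_left, ← sub_eq_zero, ← Finset.sum_sub_distrib] at h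
  simp only [starMul_C_C, PowerSeries.coeff_mk] at h
  obtain ⟨n, rfl⟩ := Nat.exists_eq_add_of_le' hn
  rw [Finset.Nat.sum_antidiagonal_eq_sum_range_succ
    (fun i j => F i (F j a b) c - F i a (F j b c)), Finset.sum_range_succ, Finset.range_eq_Ico,
    Finset.sum_eq_sum_Ico_succ_bot (by omega)] at h
  have hI : Finset.Icc 1 (n + 1 - 1) = Finset.Ico (0 + 1) (n + 1) := by
    ext i; simp only [Finset.mem_Icc, Finset.mem_Ico]; omega
  rw [hI]
  simp only [hF.1, LinearMap.mul_apply', Nat.sub_zero, Nat.sub_self] at h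
  simp only [bullet, hochschildB]
  rw [← sub_eq_zero, ← h]
  abel

end StarMul

/-! ### Deformations from free `k⟦X⟧`-algebras -/

namespace Module.Basis

variable {k A B ι : Type*} [CommRing k] [Ring A] [Algebra k A] [Ring B] [Algebra k⟦X⟧ B]
  (bA : Module.Basis ι k A) (bB : Module.Basis ι k⟦X⟧ B)

/-- The semilinear map `A → B` that sends the basis `bA` to the basis `bB`. -/
noncomputable def constLift : A →ₛₗ[(PowerSeries.C : k →+* k⟦X⟧)] B where
  toFun a := bB.repr.symm ((bA.repr a).mapRange PowerSeries.C (map_zero _))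
  map_add' a b := by
    rw [map_add, Finsupp.mapRange_add (fun _ _ => map_add _ _ _), map_add]
  map_smul' c a := by
    have h : (bA.repr (c • a)).mapRange PowerSeries.C (map_zero _) =
        (PowerSeries.C c : k⟦X⟧) • (bA.repr a).mapRange PowerSeries.C (map_zero _) := by
      ext1 i; simp
    rw [h, map_smul]

/-- The coefficient in `A` of `τ ^ n` in an element of `B`, when the elements of the basis `bA` of
`A` and of the basis `bB` of `B` are identified. -/
noncomputable def coeffAt (n : ℕ) : B →+ A where
  toFun b := bA.repr.symm ((bB.repr b).mapRange (PowerSeries.coeff n) (map_zero _))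
  map_zero' := by simp
  map_add' a b := by
    rw [map_add, Finsupp.mapRange_add (fun _ _ => map_add _ _ _), map_add]

@[simp]
theorem constLift_apply (i : ι) : bA.constLift bB (bA i) = bB i := by
  simp [constLift]

theorem coeffAt_smul_constLift (n : ℕ) (r : k⟦X⟧) (a : A) :
    bA.coeffAt bB n (r • bA.constLift bB a) = PowerSeries.coeff n r • a := by
  have h : (bB.repr (r • bA.constLift bB a)).mapRange (PowerSeries.coeff n) (map_zero _) =
      PowerSeries.coeff n r • bA.repr a := by
    ext1 i; simp [constLift]
  change bA.repr.symm _ = _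
  rw [h, map_smul, LinearEquiv.symm_apply_apply]

/-- An induction principle: the additive group `B` is generated by the multiples of the lifts of
elements of `A`. -/
theorem mem_of_smul_constLift (S : AddSubmonoid B)
    (hS : ∀ (r : k⟦X⟧) (a : A), r • bA.constLift bB a ∈ S) (b : B) : b ∈ S := by
  rw [← bB.linearCombination_repr b]
  refine sum_mem fun i _ => ?_
  have h := hS (bB.repr b i) (bA i)
  rwa [constLift_apply] at h

/-- The expansion of an element of `B` into a power series with coefficients in `A`. -/
noncomputable def expand (b : B) : A⟦X⟧ := PowerSeries.mk fun n => bA.coeffAt bB n b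

theorem expand_add (b c : B) : bA.expand bB (b + c) = bA.expand bB b + bA.expand bB c := by
  ext n
  simp [expand]

theorem expand_zero : bA.expand bB 0 = 0 := by
  ext n
  simp [expand]

theorem expand_smul_constLift (r : k⟦X⟧) (a : A) :
    bA.expand bB (r • bA.constLift bB a) = scal r (PowerSeries.C a) := by
  ext n
  rw [expand, PowerSeries.coeff_mk, coeffAt_smul_constLift, scal, PowerSeries.coeff_mul_C,
    PowerSeries.coeff_map, Algebra.smul_def]

theorem expand_constLift (a : A) : bA.expand bB (bA.constLift bB a) = PowerSeries.C a := by
  have h := bA.expand_smul_constLift bB 1 a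
  rwa [one_smul, scal_one] at h

theorem expand_smul (r : k⟦X⟧) (b : B) : bA.expand bB (r • b) = scal r (bA.expand bB b) := by
  let S : AddSubmonoid B :=
    { carrier := {b | bA.expand bB (r • b) = scal r (bA.expand bB b)}
      zero_mem' := by simp [expand_zero, scal_zero]
      add_mem' := fun {b c} hb hc => by
        simp only [Set.mem_ofPred_eq] at hb hc ⊢
        rw [smul_add, expand_add, expand_add, scal_add, hb, hc] }
  refine bA.mem_of_smul_constLift bB S (fun t a => ?_) b
  change _ = _
  rw [smul_smul, expand_smul_constLift, expand_smul_constLift, scal_mul]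

theorem coeffAt_smul (n : ℕ) (r : k⟦X⟧) (b : B) : bA.coeffAt bB n (r • b) =
    ∑ p ∈ Finset.HasAntidiagonal.antidiagonal n,
      PowerSeries.coeff p.1 r • bA.coeffAt bB p.2 b := by
  have h := congrArg (PowerSeries.coeff n) (bA.expand_smul bB r b)
  simpa only [coeff_scal, expand, PowerSeries.coeff_mk] using h

theorem coeffAt_C_smul (n : ℕ) (c : k) (b : B) :
    bA.coeffAt bB n ((PowerSeries.C c : k⟦X⟧) • b) = c • bA.coeffAt bB n b := by
  rw [coeffAt_smul, Finset.sum_eq_single (0, n)]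
  · simp
  · rintro ⟨i, j⟩ h hne
    have hi : i ≠ 0 := by
      rintro rfl
      simp only [Finset.HasAntidiagonal.mem_antidiagonal, zero_add] at h
      exact hne (by rw [h])
    simp [PowerSeries.coeff_C, hi]
  · simp

theorem coeffAt_constLift (n : ℕ) (a : A) :
    bA.coeffAt bB n (bA.constLift bB a) = if n = 0 then a else 0 := by
  have h := bA.coeffAt_smul_constLift bB n 1 a
  rw [one_smul, PowerSeries.coeff_one] at h
  rw [h]
  split_ifs <;> simp

theorem expand_injective : Function.Injective (bA.expand bB) := by
  intro b c h
  refine bB.repr.injective (Finsupp.ext fun i => PowerSeries.ext fun n => ?_)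
  have hn := congrArg (fun u => bA.repr (PowerSeries.coeff n u) i) h
  simpa [expand, coeffAt] using hn

/-- The multiplication of `B`, restricted to (the image of) `A`, is `∑ₙ F_n(u, v) τ^n` for the
bilinear maps `F_n = inducedCochain n`. -/
noncomputable def inducedCochain (n : ℕ) : HochschildTwo k A :=
  LinearMap.mk₂ k (fun u v => bA.coeffAt bB n (bA.constLift bB u * bA.constLift bB v))
    (fun u u' v => by rw [map_add, add_mul, map_add])
    (fun c u v => by rw [LinearMap.map_smulₛₗ, smul_mul_assoc, coeffAt_C_smul])
    (fun u v v' => by rw [map_add, mul_add, map_add])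
    (fun c u v => by rw [LinearMap.map_smulₛₗ, mul_smul_comm, coeffAt_C_smul])

theorem inducedCochain_apply (n : ℕ) (u v : A) : bA.inducedCochain bB n u v =
    bA.coeffAt bB n (bA.constLift bB u * bA.constLift bB v) := rfl

/-- The expansion carries the multiplication of `B` to the star product. -/
theorem expand_mul (b c : B) : bA.expand bB (b * c) =
    starMul (bA.inducedCochain bB) (bA.expand bB b) (bA.expand bB c) := by
  let S : AddSubmonoid B :=
    { carrier := {b | ∀ c, bA.expand bB (b * c) =
        starMul (bA.inducedCochain bB) (bA.expand bB b) (bA.expand bB c)}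
      zero_mem' := fun c => by rw [zero_mul, expand_zero, starMul_zero_left]
      add_mem' := fun {b b'} hb hb' c => by
        rw [add_mul, expand_add, expand_add, starMul_add_left, hb, hb'] }
  refine bA.mem_of_smul_constLift bB S (fun r u c => ?_) b c
  let S' : AddSubmonoid B :=
    { carrier := {c | bA.expand bB (r • bA.constLift bB u * c) =
        starMul (bA.inducedCochain bB) (bA.expand bB (r • bA.constLift bB u)) (bA.expand bB c)}
      zero_mem' := by
        simp only [Set.mem_ofPred_eq]
        rw [mul_zero, expand_zero, starMul_zero_right]
      add_mem' := fun {c c'} hc hc' => by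
        simp only [Set.mem_ofPred_eq] at hc hc' ⊢
        rw [mul_add, expand_add, expand_add, starMul_add_right, hc, hc'] }
  refine bA.mem_of_smul_constLift bB S' (fun t v => ?_) c
  change _ = _
  rw [smul_mul_assoc, mul_smul_comm, expand_smul, expand_smul, expand_smul, expand_smul,
    expand_constLift, expand_constLift, starMul_scal_left, starMul_scal_right, starMul_C_C]
  rfl

theorem inducedCochain_assoc (u v w : A⟦X⟧) :
    starMul (bA.inducedCochain bB) (starMul (bA.inducedCochain bB) u v) w =
      starMul (bA.inducedCochain bB) u (starMul (bA.inducedCochain bB) v w) := by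
  refine starMul_assoc_of_const _ (fun a b c => ?_) u v w
  simp only [← bA.expand_constLift bB, ← expand_mul, mul_assoc]

theorem condA_inducedCochain (h1 : bA.constLift bB 1 = 1) {n : ℕ} (hn : 1 ≤ n) :
    CondA (bA.inducedCochain bB n) := by
  constructor <;> intro u <;>
    simp [inducedCochain_apply, h1, coeffAt_constLift, show n ≠ 0 by omega]

/-- If the lift of `1` is `1` and the multiplication of `B` lifts that of `A`, then `B` defines a
formal deformation of `A`. -/
noncomputable def deformation (h1 : bA.constLift bB 1 = 1)
    (h0 : bA.inducedCochain bB 0 = LinearMap.mul k A) : UnitalFormalDeformation k A where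
  F := bA.inducedCochain bB
  isFormalDeformation := ⟨h0, bA.inducedCochain_assoc bB⟩
  condA _ hn := bA.condA_inducedCochain bB h1 hn

section Tilde

variable (h1 : bA.constLift bB 1 = 1) (h0 : bA.inducedCochain bB 0 = LinearMap.mul k A)

/-- The expansion, as a morphism of `k⟦X⟧`-algebras from `B` to `A⟦X⟧` with the star product. -/
noncomputable def expandAlgHom : B →ₐ[k⟦X⟧] (bA.deformation bB h1 h0).Series :=
  AlgHom.ofLinearMap
    { toFun := fun b => (bA.expand bB b : A⟦X⟧)
      map_add' := bA.expand_add bB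
      map_smul' := bA.expand_smul bB }
    (by
      change bA.expand bB 1 = PowerSeries.C 1
      rw [← h1, expand_constLift])
    (bA.expand_mul bB)

theorem expandAlgHom_constLift (a : A) : bA.expandAlgHom bB h1 h0 (bA.constLift bB a) =
    (bA.deformation bB h1 h0).const a := bA.expand_constLift bB a

theorem range_expandAlgHom :
    LinearMap.range (bA.expandAlgHom bB h1 h0).toLinearMap =
      (bA.deformation bB h1 h0).tildeSubmodule := by
  refine le_antisymm ?_ (Submodule.span_le.2 ?_)
  · rintro _ ⟨b, rfl⟩
    refine bA.mem_of_smul_constLift bB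
      ((bA.deformation bB h1 h0).tildeSubmodule.comap
        (bA.expandAlgHom bB h1 h0).toLinearMap).toAddSubmonoid (fun r a => ?_) b
    refine Submodule.smul_mem _ _ ?_
    change bA.expandAlgHom bB h1 h0 (bA.constLift bB a) ∈
      (bA.deformation bB h1 h0).tildeSubmodule
    rw [expandAlgHom_constLift]
    exact Submodule.subset_span ⟨a, rfl⟩
  · rintro _ ⟨a, rfl⟩
    exact ⟨bA.constLift bB a, bA.expandAlgHom_constLift bB h1 h0 a⟩

/-- `B` is isomorphic to the subalgebra `Ã` of `A⟦X⟧`. -/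
noncomputable def equivTilde (hD : IsLocallyFinite (bA.deformation bB h1 h0).F) :
    B ≃ₐ[k⟦X⟧] (bA.deformation bB h1 h0).tilde hD :=
  AlgEquiv.ofBijective
    ((bA.expandAlgHom bB h1 h0).codRestrict ((bA.deformation bB h1 h0).tilde hD) fun b => by
      change bA.expandAlgHom bB h1 h0 b ∈ (bA.deformation bB h1 h0).tildeSubmodule
      rw [← range_expandAlgHom]
      exact ⟨b, rfl⟩)
    ⟨fun b c h => bA.expand_injective bB (congrArg Subtype.val h), fun ⟨u, hu⟩ => by
      change u ∈ (bA.deformation bB h1 h0).tildeSubmodule at hu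
      rw [← range_expandAlgHom] at hu
      obtain ⟨b, hb⟩ := hu
      exact ⟨b, Subtype.ext hb⟩⟩

theorem equivTilde_symm_inTilde (hD : IsLocallyFinite (bA.deformation bB h1 h0).F) (a : A) :
    (bA.equivTilde bB h1 h0 hD).symm ((bA.deformation bB h1 h0).inTilde hD a) =
      bA.constLift bB a := by
  rw [AlgEquiv.symm_apply_eq]
  exact Subtype.ext (bA.expandAlgHom_constLift bB h1 h0 a).symm

end Tilde

end Module.Basis

/-- Since an element of `B` involves only finitely many elements of the basis, all its
coefficients lie in a common finite dimensional subspace. -/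
theorem Module.Basis.isLocallyFinite_inducedCochain {k A B ι : Type*} [Field k] [Ring A]
    [Algebra k A] [Ring B] [Algebra k⟦X⟧ B] (bA : Module.Basis ι k A)
    (bB : Module.Basis ι k⟦X⟧ B) : IsLocallyFinite (bA.inducedCochain bB) := by
  intro u v
  let S : AddSubmonoid B :=
    { carrier := {b | ∃ W : Submodule k A, W.FG ∧ ∀ n, bA.coeffAt bB n b ∈ W}
      zero_mem' := ⟨⊥, Submodule.fg_bot, fun n => by simp⟩
      add_mem' := by
        rintro b c ⟨W, hW, hb⟩ ⟨W', hW', hc⟩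
        refine ⟨W ⊔ W', hW.sup hW', fun n => ?_⟩
        rw [map_add]
        exact Submodule.add_mem_sup (hb n) (hc n) }
  obtain ⟨W, hW, h⟩ := bA.mem_of_smul_constLift bB S
    (fun r a => ⟨k ∙ a, Submodule.fg_span_singleton a, fun n => by
      rw [coeffAt_smul_constLift]
      exact Submodule.smul_mem _ _ (Submodule.mem_span_singleton_self a)⟩)
    (bA.constLift bB u * bA.constLift bB v)
  have : Module.Finite k W := Module.Finite.iff_fg.2 hW
  refine Submodule.FG.of_le hW (Submodule.span_le.2 ?_)
  rintro _ ⟨n, -, rfl⟩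
  exact h n

/-! ### The family obtained from `k⟦τ⟧[z; (1 - τ) lam, 0, φ(z)]` -/

theorem PowerSeries.coeff_one_sub_X_pow {k : Type*} [CommRing k] (r n : ℕ) :
    PowerSeries.coeff n ((1 - PowerSeries.X : k⟦X⟧) ^ r) = (-1) ^ n * (r.choose n : k) := by
  have h : (1 - PowerSeries.X : k⟦X⟧) ^ r =
      PowerSeries.rescale (-1) (((1 + Polynomial.X : k[X]) ^ r : k[X]) : k⟦X⟧) := by
    simp [PowerSeries.rescale_X, sub_eq_add_neg]
  rw [h, PowerSeries.coeff_rescale, Polynomial.coeff_coe, Polynomial.coeff_one_add_X_pow]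

namespace PolyGWA

variable {k : Type*} [Field k] (lam : kˣ) (φ : k[X])

/-- The unit `(1 - τ) lam` of `k⟦τ⟧`. -/
noncomputable def deformedUnit : (k⟦X⟧)ˣ where
  val := (1 - PowerSeries.X) * PowerSeries.C (lam : k)
  inv := PowerSeries.C ((lam⁻¹ : kˣ) : k) * PowerSeries.mk (1 : ℕ → k)
  val_inv := by
    have h := PowerSeries.mk_one_mul_one_sub_eq_one k
    rw [mul_assoc, ← mul_assoc (PowerSeries.C _), ← map_mul, Units.mul_inv, map_one, one_mul,
      mul_comm, h]
  inv_val := by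
    have h := PowerSeries.mk_one_mul_one_sub_eq_one k
    rw [mul_assoc, ← mul_assoc (PowerSeries.mk (1 : ℕ → k)), h, one_mul, ← map_mul, Units.inv_mul,
      map_one]

theorem val_deformedUnit :
    (deformedUnit lam : k⟦X⟧) = (1 - PowerSeries.X) * PowerSeries.C (lam : k) := rfl

theorem val_inv_deformedUnit : ((deformedUnit lam)⁻¹ : (k⟦X⟧)ˣ) =
    PowerSeries.C ((lam⁻¹ : kˣ) : k) * PowerSeries.mk (1 : ℕ → k) := rfl

theorem coeff_deformedUnit_pow (r n : ℕ) : PowerSeries.coeff n ((deformedUnit lam : k⟦X⟧) ^ r) =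
    (-1) ^ n * (r.choose n : k) * (lam : k) ^ r := by
  rw [val_deformedUnit, mul_pow, ← map_pow, PowerSeries.coeff_mul_C,
    PowerSeries.coeff_one_sub_X_pow]

theorem coeff_inv_deformedUnit (n : ℕ) :
    PowerSeries.coeff n (((deformedUnit lam)⁻¹ : (k⟦X⟧)ˣ) : k⟦X⟧) = ((lam⁻¹ : kˣ) : k) := by
  simp [val_inv_deformedUnit]

theorem coeff_zero_inv_deformedUnit_pow (r : ℕ) :
    PowerSeries.coeff 0 ((((deformedUnit lam)⁻¹ : (k⟦X⟧)ˣ) : k⟦X⟧) ^ r) =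
      ((lam⁻¹ : kˣ) : k) ^ r := by
  rw [PowerSeries.coeff_zero_eq_constantCoeff_apply, map_pow,
    ← PowerSeries.coeff_zero_eq_constantCoeff_apply, coeff_inv_deformedUnit]

theorem coeff_one_inv_deformedUnit_pow (r : ℕ) :
    PowerSeries.coeff 1 ((((deformedUnit lam)⁻¹ : (k⟦X⟧)ˣ) : k⟦X⟧) ^ r) =
      r * ((lam⁻¹ : kˣ) : k) ^ r := by
  rw [PowerSeries.coeff_one_pow, ← PowerSeries.coeff_zero_eq_constantCoeff_apply,
    coeff_inv_deformedUnit, coeff_inv_deformedUnit]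
  rcases r with _ | r
  · simp
  · rw [Nat.add_sub_cancel, pow_succ', mul_assoc]

/-- The generalized Weyl algebra `k⟦τ⟧[z; (1 - τ) lam, 0, φ(z)]`. -/
abbrev Deformed : Type _ := PolyGWA (deformedUnit lam) 0 (φ.map (PowerSeries.C : k →+* k⟦X⟧))

/-- The semilinear map that sends `z ^ p x_q` to `z ^ p x_q`. -/
noncomputable abbrev defLift : PolyGWA lam 0 φ →ₛₗ[(PowerSeries.C : k →+* k⟦X⟧)] Deformed lam φ :=
  (basis lam φ).constLift (basis (deformedUnit lam) (φ.map PowerSeries.C))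

/-- The coefficient of `τ ^ n` with respect to the elements `z ^ p x_q`. -/
noncomputable abbrev defCoeff (n : ℕ) : Deformed lam φ →+ PolyGWA lam 0 φ :=
  (basis lam φ).coeffAt (basis (deformedUnit lam) (φ.map PowerSeries.C)) n

/-- The family `F_n`: the coefficient of `τ ^ n` in the multiplication of
`k⟦τ⟧[z; (1 - τ) lam, 0, φ(z)]`, with respect to the elements `z ^ p x_q`. -/
noncomputable abbrev defF (n : ℕ) : HochschildTwo k (PolyGWA lam 0 φ) :=
  (basis lam φ).inducedCochain (basis (deformedUnit lam) (φ.map PowerSeries.C)) n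

theorem defF_apply (n : ℕ) (u v : PolyGWA lam 0 φ) :
    defF lam φ n u v = defCoeff lam φ n (defLift lam φ u * defLift lam φ v) := rfl

theorem defLift_basisElt (p : ℕ) (q : ℤ) : defLift lam φ (basisElt lam 0 φ p q) =
    basisElt (deformedUnit lam) 0 (φ.map PowerSeries.C) p q := by
  rw [← basis_apply, ← basis_apply, defLift, Module.Basis.constLift_apply]

theorem defLift_z_pow_mul_x_pow (p q : ℕ) :
    defLift lam φ (z lam 0 φ ^ p * x lam 0 φ ^ q) = z _ 0 _ ^ p * x _ 0 _ ^ q := by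
  have h := defLift_basisElt lam φ p q
  rwa [basisElt, basisElt, xPow_natCast, xPow_natCast] at h

theorem defLift_z_pow_mul_y_pow (p q : ℕ) :
    defLift lam φ (z lam 0 φ ^ p * y lam 0 φ ^ q) = z _ 0 _ ^ p * y _ 0 _ ^ q := by
  have h := defLift_basisElt lam φ p (-q)
  rwa [basisElt, basisElt, xPow_neg_natCast, xPow_neg_natCast] at h

theorem defLift_one : defLift lam φ 1 = 1 := by simpa using defLift_z_pow_mul_x_pow lam φ 0 0

theorem defLift_x : defLift lam φ (x lam 0 φ) = x _ 0 _ := by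
  simpa using defLift_z_pow_mul_x_pow lam φ 0 1

theorem defLift_y : defLift lam φ (y lam 0 φ) = y _ 0 _ := by
  simpa using defLift_z_pow_mul_y_pow lam φ 0 1

theorem defLift_z : defLift lam φ (z lam 0 φ) = z _ 0 _ := by
  simpa using defLift_z_pow_mul_x_pow lam φ 1 0

theorem defLift_ofPoly_mul_xPow (h : k[X]) (q : ℤ) :
    defLift lam φ (ofPoly lam 0 φ h * xPow lam 0 φ q) =
      ofPoly _ 0 _ (h.map PowerSeries.C) * xPow _ 0 _ q := by
  induction h using Polynomial.induction_on' with
  | add g h hg hh => simp only [ofPoly_add, add_mul, map_add, hg, hh, Polynomial.map_add]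
  | monomial p c =>
    rw [Polynomial.map_monomial, ofPoly_monomial, ofPoly_monomial, smul_mul_assoc, smul_mul_assoc,
      LinearMap.map_smulₛₗ]
    exact congrArg _ (defLift_basisElt lam φ p q)

theorem defLift_z_mul (u : PolyGWA lam 0 φ) :
    defLift lam φ (z lam 0 φ * u) = z _ 0 _ * defLift lam φ u := by
  have h : (defLift lam φ).comp (LinearMap.mulLeft k (z lam 0 φ)) =
      (LinearMap.mulLeft k⟦X⟧ (z _ 0 _)).comp (defLift lam φ) := by
    refine (basis lam φ).ext fun ⟨p, q⟩ => ?_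
    rw [basis_apply, LinearMap.comp_apply, LinearMap.comp_apply, LinearMap.mulLeft_apply,
      LinearMap.mulLeft_apply, defLift_basisElt, basisElt, basisElt, ← mul_assoc, ← mul_assoc,
      ← pow_succ', ← pow_succ']
    exact defLift_basisElt lam φ (p + 1) q
  exact LinearMap.congr_fun h u

theorem defCoeff_z_mul (n : ℕ) (b : Deformed lam φ) :
    defCoeff lam φ n (z _ 0 _ * b) = z lam 0 φ * defCoeff lam φ n b := by
  let S : AddSubmonoid (Deformed lam φ) :=
    { carrier := {b | defCoeff lam φ n (z _ 0 _ * b) = z lam 0 φ * defCoeff lam φ n b}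
      zero_mem' := by simp
      add_mem' := fun {b c} hb hc => by
        simp only [Set.mem_ofPred_eq] at hb hc ⊢
        rw [mul_add, map_add, map_add, hb, hc, mul_add] }
  refine (basis lam φ).mem_of_smul_constLift
    (basis (deformedUnit lam) (φ.map PowerSeries.C)) S (fun r a => ?_) b
  change _ = _
  rw [mul_smul_comm, ← defLift_z_mul, Module.Basis.coeffAt_smul_constLift,
    Module.Basis.coeffAt_smul_constLift, mul_smul_comm]

theorem defCoeff_z_pow_mul (n p : ℕ) (b : Deformed lam φ) :
    defCoeff lam φ n (z _ 0 _ ^ p * b) = z lam 0 φ ^ p * defCoeff lam φ n b := by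
  induction p with
  | zero => simp
  | succ p ih => rw [pow_succ', mul_assoc, defCoeff_z_mul, ih, ← mul_assoc, ← pow_succ']

theorem defCoeff_smul_defLift (n : ℕ) (r : k⟦X⟧) (a : PolyGWA lam 0 φ) :
    defCoeff lam φ n (r • defLift lam φ a) = PowerSeries.coeff n r • a :=
  Module.Basis.coeffAt_smul_constLift ..

theorem condB_defF {n : ℕ} (hn : 1 ≤ n) : CondB lam 0 φ (defF lam φ n) := by
  refine ⟨fun u v => ?_, fun q j => ⟨?_, ?_⟩⟩
  · rw [defF_apply, defF_apply, defLift_z_mul, mul_assoc, defCoeff_z_mul]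
  · have h : ∀ m, defLift lam φ (x lam 0 φ ^ m) = x _ 0 _ ^ m := fun m => by
      simpa using defLift_z_pow_mul_x_pow lam φ 0 m
    rw [defF_apply, h, h, ← pow_add, ← h, Module.Basis.coeffAt_constLift, if_neg (by omega)]
  · have h : ∀ m, defLift lam φ (y lam 0 φ ^ m) = y _ 0 _ ^ m := fun m => by
      simpa using defLift_z_pow_mul_y_pow lam φ 0 m
    rw [defF_apply, h, h, ← pow_add, ← h, Module.Basis.coeffAt_constLift, if_neg (by omega)]

theorem preservesGam_defF (n : ℕ) : PreservesGam lam 0 φ (defF lam φ n) := by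
  have hw : ∀ p q, weight (φ.map (PowerSeries.C : k →+* k⟦X⟧)) p q = weight φ p q := fun p q => by
    rw [weight, weight, Polynomial.natDegree_map_eq_of_injective PowerSeries.C_injective]
  have hc : ∀ (m : ℕ) (b : Deformed lam φ), b ∈ Gam (deformedUnit lam) 0 _ m →
      ∀ n, defCoeff lam φ n b ∈ Gam lam 0 φ m := by
    intro m b hb
    induction hb using Submodule.span_induction with
    | mem b hb =>
      obtain ⟨p, q, hpq, rfl⟩ := hb
      intro n
      rw [← defLift_basisElt, Module.Basis.coeffAt_constLift]
      split_ifs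
      · exact Submodule.subset_span ⟨p, q, hw p q ▸ hpq, rfl⟩
      · exact zero_mem _
    | zero => intro n; rw [map_zero]; exact zero_mem _
    | add b c _ _ hb hc => intro n; rw [map_add]; exact add_mem (hb n) (hc n)
    | smul r b _ hb =>
      intro n
      rw [Module.Basis.coeffAt_smul]
      exact sum_mem fun i _ => Submodule.smul_mem _ _ (hb i.2)
  intro p q p' q'
  rw [defF_apply, defLift_basisElt, defLift_basisElt, ← hw, ← hw]
  exact hc _ _ (basisElt_mul_basisElt_mem_Gam _ _ p p' q q') n

variable [CharZero k]

/-- The expansion in powers of `τ` of `φ((1 - τ) lam z)`. -/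
theorem defCoeff_ofPoly_sigmaAut_mul_xPow (n : ℕ) (g : k[X]) (q : ℤ) :
    defCoeff lam φ n (ofPoly _ 0 _ (sigmaAut (deformedUnit lam) 0 (g.map PowerSeries.C)) *
      xPow _ 0 _ q) = ((-1 : k) ^ n / (n.factorial : k)) • (ofPoly lam 0 φ
        (Polynomial.X ^ n * (Polynomial.derivative^[n] (sigmaAut lam 0 g))) *
          xPow lam 0 φ q) := by
  induction g using Polynomial.induction_on' with
  | add g h hg hh =>
    simp only [Polynomial.map_add, map_add, ofPoly_add, add_mul, hg, hh,
      iterate_map_add, mul_add, smul_add]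
  | monomial r c =>
    have hder : Polynomial.X ^ n * Polynomial.derivative^[n] (sigmaAut lam 0
        (Polynomial.monomial r c)) =
          Polynomial.monomial r ((n.factorial : k) * r.choose n * (c * (lam : k) ^ r)) := by
      rw [sigmaAut_monomial, ← Polynomial.factorial_smul_hasseDeriv, LinearMap.smul_apply,
        Polynomial.hasseDeriv_monomial, Polynomial.smul_monomial, Polynomial.X_pow_mul_monomial,
        nsmul_eq_mul, mul_assoc]
      rcases le_or_gt n r with h | h
      · rw [Nat.sub_add_cancel h]
      · simp [Nat.choose_eq_zero_of_lt h]
    rw [hder, Polynomial.map_monomial, sigmaAut_monomial, ofPoly_monomial, ofPoly_monomial,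
      smul_mul_assoc, smul_mul_assoc, smul_smul]
    change defCoeff lam φ n (_ • basisElt _ 0 _ r q) = _ • basisElt lam 0 φ r q
    rw [← defLift_basisElt, defCoeff_smul_defLift, PowerSeries.coeff_C_mul,
      coeff_deformedUnit_pow]
    congr 1
    have := Nat.cast_ne_zero (R := k).2 n.factorial_ne_zero
    field_simp

/-- At `τ = 0` the multiplication of `k⟦τ⟧[z; (1 - τ) lam, 0, φ(z)]` is that of
`k[z; lam, 0, φ(z)]`. Since both are associative, it suffices to compare products whose first factor is a
generator. -/
theorem defF_zero : defF lam φ 0 = LinearMap.mul k (PolyGWA lam 0 φ) := by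
  have hassoc : ∀ a b c, defF lam φ 0 (defF lam φ 0 a b) c = defF lam φ 0 a (defF lam φ 0 b c) := by
    intro a b c
    have h := congrArg (PowerSeries.coeff 0) ((basis lam φ).inducedCochain_assoc
      (basis (deformedUnit lam) (φ.map PowerSeries.C))
      (PowerSeries.C a) (PowerSeries.C b) (PowerSeries.C c))
    rw [coeff_starMul_C_right, coeff_starMul_C_left] at h
    simpa only [starMul_C_C, PowerSeries.coeff_mk, Finset.Nat.antidiagonal_zero,
      Finset.sum_singleton] using h
  have hx : ∀ v, defF lam φ 0 (x lam 0 φ) v = x lam 0 φ * v := by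
    refine LinearMap.congr_fun (f := defF lam φ 0 (x lam 0 φ))
      (g := LinearMap.mulLeft k (x lam 0 φ)) ((basis lam φ).ext fun ⟨p, q⟩ => ?_)
    rw [basis_apply, defF_apply, defLift_basisElt, defLift_x, x_mul_basisElt,
      Module.Basis.coeffAt_smul, LinearMap.mulLeft_apply, x_mul_basisElt]
    simp only [Finset.Nat.antidiagonal_zero, Finset.sum_singleton, coeff_deformedUnit_pow]
    rw [defCoeff_z_pow_mul]
    split_ifs
    · have h := defCoeff_ofPoly_sigmaAut_mul_xPow lam φ 0 1 (q + 1)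
      simp only [Polynomial.map_one, map_one] at h
      rw [h]; simp
    · rw [defCoeff_ofPoly_sigmaAut_mul_xPow]; simp
  have hy : ∀ v, defF lam φ 0 (y lam 0 φ) v = y lam 0 φ * v := by
    refine LinearMap.congr_fun (f := defF lam φ 0 (y lam 0 φ))
      (g := LinearMap.mulLeft k (y lam 0 φ)) ((basis lam φ).ext fun ⟨p, q⟩ => ?_)
    have hif : (if q ≤ 0 then 1 else φ.map (PowerSeries.C : k →+* k⟦X⟧)) =
        (if q ≤ 0 then 1 else φ).map PowerSeries.C := by split_ifs <;> simp
    rw [basis_apply, defF_apply, defLift_basisElt, defLift_y, y_mul_basisElt,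
      Module.Basis.coeffAt_smul, LinearMap.mulLeft_apply, y_mul_basisElt]
    simp only [Finset.Nat.antidiagonal_zero, Finset.sum_singleton, coeff_zero_inv_deformedUnit_pow]
    rw [defCoeff_z_pow_mul, hif, ← defLift_ofPoly_mul_xPow, Module.Basis.coeffAt_constLift,
      if_pos rfl]
  refine LinearMap.ext fun a => ?_
  have ha : a ∈ Algebra.adjoin k {z lam 0 φ, x lam 0 φ, y lam 0 φ} := by
    rw [adjoin_generators]; trivial
  induction ha using Algebra.adjoin_induction with
  | mem a ha =>
    obtain rfl | rfl | rfl := ha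
    · refine LinearMap.ext fun v => ?_
      rw [defF_apply, defLift_z, defCoeff_z_mul, Module.Basis.coeffAt_constLift, if_pos rfl]
      rfl
    · exact LinearMap.ext hx
    · exact LinearMap.ext hy
  | algebraMap r =>
    refine LinearMap.ext fun v => ?_
    rw [Algebra.algebraMap_eq_smul_one, map_smul, LinearMap.smul_apply, defF_apply, defLift_one,
      one_mul, Module.Basis.coeffAt_constLift, if_pos rfl]
    simp
  | add a b _ _ ha hb => rw [map_add, map_add, ha, hb]
  | mul a b _ _ ha hb =>
    refine LinearMap.ext fun v => ?_
    have hab : a * b = defF lam φ 0 a b := by rw [ha]; rfl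
    rw [hab, hassoc, hb, ha]
    simp [mul_assoc]

/-- The formal deformation of `k[z; lam, 0, φ(z)]` whose locally finite part is
`k⟦τ⟧[z; (1 - τ) lam, 0, φ(z)]`. -/
noncomputable def quantumDeformation : UnitalFormalDeformation k (PolyGWA lam 0 φ) :=
  (basis lam φ).deformation (basis (deformedUnit lam) (φ.map PowerSeries.C))
    (defLift_one lam φ) (defF_zero lam φ)

theorem sum_bullet_defF {n : ℕ} (hn : 1 ≤ n) (a b c : PolyGWA lam 0 φ) :
    ∑ i ∈ Finset.Icc 1 (n - 1), bullet (defF lam φ i) (defF lam φ (n - i)) a b c =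
      hochschildB (defF lam φ n) a b c :=
  (quantumDeformation lam φ).isFormalDeformation.sum_bullet hn a b c

theorem hasValues_defF {n : ℕ} (hn : 2 ≤ n) : HasValues lam φ n (defF lam φ n) := by
  have hzx := defLift_z_pow_mul_x_pow lam φ 1 1
  have hzy := defLift_z_pow_mul_y_pow lam φ 1 1
  simp only [pow_one] at hzx hzy
  refine ⟨?_, ?_, ?_, ?_⟩
  · have h := coeff_deformedUnit_pow lam 1 n
    rw [pow_one, Nat.choose_eq_zero_of_lt (by omega)] at h
    rw [defF_apply, defLift_x, defLift_z, x_mul_z, ← hzx, defCoeff_smul_defLift, h]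
    simp
  · rw [defF_apply, defLift_y, defLift_z, y_mul_z, ← hzy, defCoeff_smul_defLift,
      coeff_inv_deformedUnit, y_mul_z]
  · have h := defCoeff_ofPoly_sigmaAut_mul_xPow lam φ n φ 0
    simp only [xPow_zero, mul_one] at h
    rw [defF_apply, defLift_x, defLift_y, x_mul_y, h]
  · have h := defLift_ofPoly_mul_xPow lam φ φ 0
    simp only [xPow_zero, mul_one] at h
    rw [defF_apply, defLift_x, defLift_y, y_mul_x, ← h, Module.Basis.coeffAt_constLift,
      if_neg (by omega)]

end PolyGWA

/-! ### The cocycle `f(z)` and the first member of the family -/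

/-- If `W` and `Z` commute up to the factor `c`, then putting `W Z` for one of the factors `Z` and
one of the factors `W` into the monomials below yields a normally ordered monomial. -/
theorem monomial_insert {R C : Type*} [CommRing R] [Ring C] [Algebra R C] {Z W : C} {c : R}
    (h : W * Z = c • (Z * W)) (p a b s r j : ℕ) :
    Z ^ p * (c ^ (b + 1 + s) • Z) ^ a * W ^ b * (c • (Z * W)) * ((c • W) ^ s * Z ^ r * W ^ j) =
      c ^ ((b + 1 + s) * (a + 1 + r)) • (Z ^ (p + (a + 1 + r)) * W ^ (b + 1 + s + j)) := by
  have h1 : W ^ b * (c • (Z * W)) = c ^ (b + 1) • (Z * W ^ (b + 1)) := by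
    have := pow_mul_pow_of_mul_eq_smul h b 1
    rw [pow_one, mul_one] at this
    rw [mul_smul_comm, ← mul_assoc, this, smul_mul_assoc, smul_smul, mul_assoc, ← pow_succ,
      ← pow_succ']
  have h2 := pow_mul_pow_of_mul_eq_smul h (b + 1 + s) r
  calc _ = (c ^ ((b + 1 + s) * a) * (c ^ (b + 1) * c ^ s)) •
        (Z ^ p * Z ^ a * Z * (W ^ (b + 1 + s) * Z ^ r) * W ^ j) := by
        rw [mul_assoc _ (W ^ b), h1, smul_pow, smul_pow, ← pow_mul, pow_add W (b + 1) s]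
        simp only [smul_mul_assoc, mul_smul_comm, smul_smul, mul_assoc]
        congr 1; ring
    _ = _ := by
        rw [h2]
        simp only [smul_mul_assoc, mul_smul_comm, smul_smul, pow_add, pow_one, mul_assoc]
        congr 1; ring

namespace PolyGWA

section Delta

variable {R : Type*} [CommRing R] (lam : Rˣ) (φ : R[X])

-- The additive inverse of a ring quotient is not reducibly the one of its ring structure, so that
-- the general facts on negatives do not rewrite. Hence the following restatements.

protected theorem neg_mul (a b : PolyGWA lam 0 φ) : -a * b = -(a * b) := _root_.neg_mul a b

protected theorem mul_neg (a b : PolyGWA lam 0 φ) : a * -b = -(a * b) := _root_.mul_neg a b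

protected theorem smul_neg (c : R) (a : PolyGWA lam 0 φ) : c • -a = -(c • a) := _root_.smul_neg c a

protected theorem neg_smul (c : R) (a : PolyGWA lam 0 φ) : -c • a = -(c • a) := _root_.neg_smul c a

protected theorem neg_add_cancel (a : PolyGWA lam 0 φ) : -a + a = 0 := _root_.neg_add_cancel a

protected theorem sub_eq_add_neg (a b : PolyGWA lam 0 φ) : a - b = a + -b :=
  _root_.sub_eq_add_neg a b

protected theorem neg_zero : -(0 : PolyGWA lam 0 φ) = 0 := _root_.neg_zero

theorem act_tmul (m a b : PolyGWA lam 0 φ) : act lam 0 φ m (a ⊗ₜ b) = a * m * b := by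
  simp [act, mul_assoc]

theorem act_neg_right (m : PolyGWA lam 0 φ) (t : PolyGWA lam 0 φ ⊗[R] PolyGWA lam 0 φ) :
    act lam 0 φ m (-t) = -act lam 0 φ m t := map_neg (act lam 0 φ m) t

theorem act_zero (t : PolyGWA lam 0 φ ⊗[R] PolyGWA lam 0 φ) : act lam 0 φ 0 t = 0 := by
  induction t with
  | zero => exact map_zero _
  | tmul a b => rw [act_tmul, mul_zero, zero_mul]
  | add t u ht hu => rw [map_add, ht, hu, add_zero]

theorem act_neg_left (m : PolyGWA lam 0 φ) (t : PolyGWA lam 0 φ ⊗[R] PolyGWA lam 0 φ) :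
    act lam 0 φ (-m) t = -act lam 0 φ m t := by
  refine eq_neg_of_add_eq_zero_left ?_
  induction t with
  | zero => rw [map_zero, map_zero, add_zero]
  | tmul a b =>
    rw [act_tmul, act_tmul, ← add_mul, ← mul_add, PolyGWA.neg_add_cancel, mul_zero, zero_mul]
  | add t u ht hu => rw [map_add, map_add, add_add_add_comm, ht, hu, add_zero]

theorem delta_add (f g : R[X] ≃ₐ[R] R[X]) (h h' : R[X]) :
    delta lam 0 φ f g (h + h') = delta lam 0 φ f g h + delta lam 0 φ f g h' :=
  Polynomial.sum_add_index _ _ _ (fun _ => zero_smul _ _) (fun _ _ _ => add_smul _ _ _)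

theorem act_delta_monomial (f g : R[X] ≃ₐ[R] R[X]) (m : PolyGWA lam 0 φ) (r : ℕ) (c : R) :
    act lam 0 φ m (delta lam 0 φ f g (Polynomial.monomial r c)) =
      c • ∑ i ∈ Finset.range r, ofPoly lam 0 φ (f (Polynomial.X ^ (r - 1 - i))) * m *
        ofPoly lam 0 φ (g (Polynomial.X ^ i)) := by
  rw [delta, Polynomial.sum_monomial_index c _ (by rw [zero_smul]), map_smul, map_sum]
  simp only [act_tmul]

/-- The value at a monomial `h` of `z σ(h)'`, which is what all three actions on noncommutative
difference quotients below amount to. -/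
theorem X_mul_derivative_sigmaAut_monomial (r : ℕ) (c : R) :
    ofPoly lam 0 φ (Polynomial.X * Polynomial.derivative (sigmaAut lam 0
      (Polynomial.monomial r c))) = (c * (r * (lam : R) ^ r)) • z lam 0 φ ^ r := by
  rw [sigmaAut_monomial, Polynomial.derivative_monomial, Polynomial.X_mul_monomial]
  rcases r with _ | r
  · simp [ofPoly_eq_aeval]
  · rw [Nat.add_sub_cancel, ofPoly_monomial]
    congr 1; ring

/-- `lam (σΔσ)(h) · z = z σ(h)'`. -/
theorem act_delta_sigma_sigma (h : R[X]) :
    (lam : R) • act lam 0 φ (z lam 0 φ) (delta lam 0 φ (sigmaAut lam 0) (sigmaAut lam 0) h) =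
      ofPoly lam 0 φ (Polynomial.X * Polynomial.derivative (sigmaAut lam 0 h)) := by
  induction h using Polynomial.induction_on' with
  | add g h hg hh =>
    rw [delta_add, map_add, smul_add, hg, hh, map_add, map_add, mul_add, ofPoly_add]
  | monomial r c =>
    rw [act_delta_monomial, X_mul_derivative_sigmaAut_monomial,
      Finset.sum_congr rfl (g := fun _ => (lam : R) ^ (r - 1) • z lam 0 φ ^ r), Finset.sum_const,
      Finset.card_range, ← Nat.cast_smul_eq_nsmul R, smul_smul, smul_smul, smul_smul]
    · rcases r with _ | r
      · simp
      · congr 1; rw [Nat.add_sub_cancel]; ring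
    · intro i hi
      obtain ⟨a, rfl⟩ := Nat.exists_eq_add_of_lt (Finset.mem_range.1 hi)
      rw [show i + a + 1 - 1 - i = a by omega, Nat.add_sub_cancel, sigmaAut_X_pow, sigmaAut_X_pow,
        ofPoly_smul, ofPoly_smul, ofPoly_X_pow, ofPoly_X_pow, smul_mul_assoc, smul_mul_assoc,
        mul_smul_comm, smul_smul, ← pow_succ, ← pow_add, ← pow_add]
      congr 2 <;> omega

/-- `(σΔ)(h) · lam z x = z σ(h)' x`. -/
theorem act_delta_sigma_refl (h : R[X]) :
    act lam 0 φ ((lam : R) • (z lam 0 φ * x lam 0 φ))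
        (delta lam 0 φ (sigmaAut lam 0) AlgEquiv.refl h) =
      ofPoly lam 0 φ (Polynomial.X * Polynomial.derivative (sigmaAut lam 0 h)) * x lam 0 φ := by
  induction h using Polynomial.induction_on' with
  | add g h hg hh => rw [delta_add, map_add, hg, hh, map_add, map_add, mul_add, ofPoly_add, add_mul]
  | monomial r c =>
    rw [act_delta_monomial, X_mul_derivative_sigmaAut_monomial,
      Finset.sum_congr rfl (g := fun _ => (lam : R) ^ r • (z lam 0 φ ^ r * x lam 0 φ)),
      Finset.sum_const, Finset.card_range, ← Nat.cast_smul_eq_nsmul R, smul_smul, smul_smul,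
      smul_mul_assoc, mul_assoc]
    intro i hi
    obtain ⟨a, rfl⟩ := Nat.exists_eq_add_of_lt (Finset.mem_range.1 hi)
    have hm := monomial_insert (x_mul_z lam φ) 0 a 0 0 i 0
    rw [show i + a + 1 - 1 - i = a by omega, sigmaAut_X_pow, AlgEquiv.coe_refl, id,
      ofPoly_smul, ofPoly_X_pow, ofPoly_X_pow, ← smul_pow, show i + a + 1 = a + 1 + i by omega]
    simpa using hm

/-- `lam (Δσ)(h) · y z = y z σ(h)'`. -/
theorem act_delta_refl_sigma (h : R[X]) :
    (lam : R) • act lam 0 φ (y lam 0 φ * z lam 0 φ)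
        (delta lam 0 φ AlgEquiv.refl (sigmaAut lam 0) h) =
      y lam 0 φ * ofPoly lam 0 φ
        (Polynomial.X * Polynomial.derivative (sigmaAut lam 0 h)) := by
  induction h using Polynomial.induction_on' with
  | add g h hg hh =>
    rw [delta_add, map_add, smul_add, hg, hh, map_add, map_add, mul_add, ofPoly_add, mul_add]
  | monomial r c =>
    rw [act_delta_monomial, X_mul_derivative_sigmaAut_monomial,
      Finset.sum_congr rfl (g := fun _ => (lam : R) ^ (r - 1) • (y lam 0 φ * z lam 0 φ ^ r)),
      Finset.sum_const, Finset.card_range, ← Nat.cast_smul_eq_nsmul R, mul_smul_comm,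
      smul_smul, smul_smul, smul_smul]
    · rcases r with _ | r
      · simp
      · congr 1; rw [Nat.add_sub_cancel]; ring
    · intro i hi
      obtain ⟨a, rfl⟩ := Nat.exists_eq_add_of_lt (Finset.mem_range.1 hi)
      have hy : z lam 0 φ ^ a * y lam 0 φ = (lam : R) ^ a • (y lam 0 φ * z lam 0 φ ^ a) := by
        rw [y_mul_z_pow, smul_smul, ← mul_pow, Units.mul_inv, one_pow, one_smul]
      rw [show i + a + 1 - 1 - i = a by omega, Nat.add_sub_cancel, sigmaAut_X_pow,
        AlgEquiv.coe_refl, id, ofPoly_smul, ofPoly_X_pow, ofPoly_X_pow,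
        mul_smul_comm, ← mul_assoc, hy, smul_mul_assoc, smul_mul_assoc, smul_smul, ← pow_add,
        mul_assoc, mul_assoc, ← pow_succ', ← pow_add]
      congr 3; omega

theorem perF_three : perF lam 0 φ (z lam 0 φ) 3 =
    -ofPoly lam 0 φ (Polynomial.X * Polynomial.derivative (sigmaAut lam 0 φ)) := by
  rw [← act_delta_sigma_sigma]; rfl

theorem sigmaZ_natCast (q : ℕ) : sigmaZ lam 0 φ q = (lam : R) ^ q • z lam 0 φ := by
  have h : (sigmaAut lam 0 ^ q : R[X] ≃ₐ[R] R[X]) Polynomial.X =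
      (lam : R) ^ q • Polynomial.X := by
    have h1 := sigmaAut_X_pow lam 1
    rw [pow_one, pow_one] at h1
    induction q with
    | zero => simp
    | succ q ih => rw [pow_succ, AlgEquiv.mul_apply, h1, map_smul, ih, smul_smul, pow_succ']
  rw [sigmaZ, zpow_natCast, h, ofPoly_smul]
  rfl

theorem sigmaZ_neg_natCast (q : ℕ) :
    sigmaZ lam 0 φ (-q) = ((lam⁻¹ : Rˣ) : R) ^ q • z lam 0 φ := by
  have h : ((sigmaAut lam 0)⁻¹ ^ q : R[X] ≃ₐ[R] R[X]) Polynomial.X =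
      ((lam⁻¹ : Rˣ) : R) ^ q • Polynomial.X := by
    have h1 : ((sigmaAut lam 0)⁻¹ : R[X] ≃ₐ[R] R[X]) Polynomial.X =
        ((lam⁻¹ : Rˣ) : R) • Polynomial.X := by
      have h1 := sigmaAut_symm_X_pow lam 1
      rwa [pow_one, pow_one] at h1
    induction q with
    | zero => simp
    | succ q ih => rw [pow_succ, AlgEquiv.mul_apply, h1, map_smul, ih, smul_smul, pow_succ']
  rw [sigmaZ, zpow_neg, zpow_natCast, ← inv_pow, h, ofPoly_smul]
  rfl

theorem isPerTwoCocycle_perF_z : IsPerTwoCocycle lam 0 φ (perF lam 0 φ (z lam 0 φ)) := by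
  have h0 : perF lam 0 φ (z lam 0 φ) 0 = (lam : R) • (z lam 0 φ * x lam 0 φ) := rfl
  have h1 : perF lam 0 φ (z lam 0 φ) 1 = -(y lam 0 φ * z lam 0 φ) := rfl
  have h2 : perF lam 0 φ (z lam 0 φ) 2 = 0 := rfl
  have hz : z lam 0 φ = ofPoly lam 0 φ Polynomial.X := rfl
  have hcomm : ∀ g h, ofPoly lam 0 φ g * ofPoly lam 0 φ h = ofPoly lam 0 φ h * ofPoly lam 0 φ g :=
    fun g h => by rw [← ofPoly_mul, mul_comm, ofPoly_mul]
  refine ⟨?_, ?_, ?_, ?_⟩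
  · rw [h0, h1, h2, PolyGWA.sub_eq_add_neg, PolyGWA.sub_eq_add_neg, PolyGWA.neg_mul,
      PolyGWA.smul_neg, neg_neg, mul_smul_comm, mul_assoc, PolyGWA.neg_add_cancel, mul_zero,
      zero_mul, zero_add, PolyGWA.neg_zero, add_zero]
  · rw [h0, h1, perF_three, sigmaZ, PolyGWA.sub_eq_add_neg, PolyGWA.sub_eq_add_neg,
      PolyGWA.mul_neg, PolyGWA.mul_neg, PolyGWA.neg_mul, neg_neg, neg_neg, hcomm,
      PolyGWA.neg_add_cancel, smul_zero, add_zero, smul_mul_assoc, smul_smul, Units.inv_mul,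
      one_smul, mul_assoc, x_mul_y, ← mul_assoc, x_mul_y, hz, hcomm, PolyGWA.neg_add_cancel]
  · rw [h0, h2, act_delta_sigma_refl, perF_three, PolyGWA.sub_eq_add_neg, PolyGWA.neg_mul,
      neg_neg, mul_zero, zero_add, PolyGWA.neg_add_cancel]
  · rw [h1, h2, act_neg_left, PolyGWA.smul_neg, act_delta_refl_sigma, perF_three, neg_neg,
      zero_mul, PolyGWA.mul_neg, PolyGWA.neg_zero, zero_add, add_comm, PolyGWA.neg_add_cancel]

end Delta

section Correspondence

variable {k : Type*} [Field k] (lam : kˣ) (φ : k[X])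

theorem isHochschildTwoCocycle_defF_one [CharZero k] :
    IsHochschildTwoCocycle (defF lam φ 1) := fun a b c => by
  rw [← sum_bullet_defF lam φ le_rfl]
  simp

theorem defF_one_x_x (p q i j : ℕ) :
    defF lam φ 1 (z lam 0 φ ^ p * x lam 0 φ ^ q) (z lam 0 φ ^ i * x lam 0 φ ^ j) =
      -(((i * q : ℕ) : k) • (lam : k) ^ (q * i) •
        (z lam 0 φ ^ (p + i) * x lam 0 φ ^ (q + j))) := by
  rw [defF_apply, defLift_z_pow_mul_x_pow, defLift_z_pow_mul_x_pow, mul_assoc,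
    ← mul_assoc (x _ _ _ ^ q), x_pow_mul_z_pow, smul_mul_assoc, mul_smul_comm, mul_assoc,
    ← pow_add, ← mul_assoc, ← pow_add, ← defLift_z_pow_mul_x_pow, defCoeff_smul_defLift,
    coeff_deformedUnit_pow, smul_smul, ← neg_smul, Nat.choose_one_right, mul_comm i q]
  congr 1; ring

theorem defF_one_y_y (p q i j : ℕ) :
    defF lam φ 1 (z lam 0 φ ^ p * y lam 0 φ ^ q) (z lam 0 φ ^ i * y lam 0 φ ^ j) =
      ((i * q : ℕ) : k) • ((lam⁻¹ : kˣ) : k) ^ (q * i) •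
        (z lam 0 φ ^ (p + i) * y lam 0 φ ^ (q + j)) := by
  rw [defF_apply, defLift_z_pow_mul_y_pow, defLift_z_pow_mul_y_pow, mul_assoc,
    ← mul_assoc (y _ _ _ ^ q), y_pow_mul_z_pow, smul_mul_assoc, mul_smul_comm, mul_assoc,
    ← pow_add, ← mul_assoc, ← pow_add, ← defLift_z_pow_mul_y_pow, defCoeff_smul_defLift,
    coeff_one_inv_deformedUnit_pow, smul_smul, mul_comm i q]

theorem defF_one_x_y [CharZero k] (p i j : ℕ) :
    defF lam φ 1 (z lam 0 φ ^ p * x lam 0 φ) (z lam 0 φ ^ i * y lam 0 φ ^ (j + 1)) =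
      -((i : k) • (lam : k) ^ i • (z lam 0 φ ^ (p + i) * x lam 0 φ * y lam 0 φ ^ (j + 1))) +
        -((lam : k) ^ i • (z lam 0 φ ^ (p + i) * ofPoly lam 0 φ
          (Polynomial.X * Polynomial.derivative (sigmaAut lam 0 φ)) * y lam 0 φ ^ j)) := by
  have h := defLift_z_pow_mul_x_pow lam φ p 1
  simp only [pow_one] at h
  rw [defF_apply, h, defLift_z_pow_mul_y_pow, mul_assoc,
    ← mul_assoc (x _ _ _), x_mul_z_pow, smul_mul_assoc, mul_smul_comm, mul_assoc, pow_succ',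
    ← mul_assoc (x _ _ _), x_mul_y, ← mul_assoc (z _ _ _ ^ p), ← pow_add,
    Module.Basis.coeffAt_smul,
    show Finset.HasAntidiagonal.antidiagonal 1 = {((0 : ℕ), (1 : ℕ)), (1, 0)} from rfl,
    Finset.sum_pair (by decide), coeff_deformedUnit_pow, coeff_deformedUnit_pow,
    ← xPow_neg_natCast, defCoeff_z_pow_mul, defCoeff_z_pow_mul,
    defCoeff_ofPoly_sigmaAut_mul_xPow, defCoeff_ofPoly_sigmaAut_mul_xPow, xPow_neg_natCast,
    mul_assoc (z lam 0 φ ^ (p + i)) (x lam 0 φ), pow_succ' (y lam 0 φ), ← mul_assoc (x lam 0 φ),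
    x_mul_y, add_comm]
  simp [mul_assoc, smul_smul, PolyGWA.neg_smul, PolyGWA.mul_neg]

theorem defF_one_y_x (p i j : ℕ) :
    defF lam φ 1 (z lam 0 φ ^ p * y lam 0 φ) (z lam 0 φ ^ i * x lam 0 φ ^ (j + 1)) =
      (i : k) • ((lam⁻¹ : kˣ) : k) ^ i •
        (z lam 0 φ ^ (p + i) * y lam 0 φ * x lam 0 φ ^ (j + 1)) := by
  have h := defLift_z_pow_mul_y_pow lam φ p 1
  simp only [pow_one] at h
  have hl : defLift lam φ (z lam 0 φ ^ (p + i) * (ofPoly lam 0 φ φ * xPow lam 0 φ j)) =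
      z _ 0 _ ^ (p + i) * (ofPoly _ 0 _ (φ.map PowerSeries.C) * xPow _ 0 _ j) := by
    have h1 := defLift_ofPoly_mul_xPow lam φ (Polynomial.X ^ (p + i) * φ) j
    simpa [mul_assoc] using h1
  rw [defF_apply, h, defLift_z_pow_mul_x_pow, mul_assoc,
    ← mul_assoc (y _ _ _), y_mul_z_pow, smul_mul_assoc, mul_smul_comm, mul_assoc, pow_succ',
    ← mul_assoc (y _ _ _), y_mul_x, ← mul_assoc (z _ _ _ ^ p), ← pow_add, ← xPow_natCast, ← hl,
    defCoeff_smul_defLift, coeff_one_inv_deformedUnit_pow, pow_succ', mul_assoc _ (y _ _ _),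
    ← mul_assoc (y _ _ _), y_mul_x, xPow_natCast, smul_smul]

/-- The first coefficient of the deformation is the cocycle that corresponds to `f(z)`. -/
theorem correspondsTo_defF_one [CharZero k] :
    CorrespondsTo lam 0 φ (defF lam φ 1) (perF lam 0 φ (z lam 0 φ)) := by
  have h0 : perF lam 0 φ (z lam 0 φ) 0 = (lam : k) • (z lam 0 φ * x lam 0 φ) := rfl
  have h1 : perF lam 0 φ (z lam 0 φ) 1 =
      -(((lam⁻¹ : kˣ) : k) • (z lam 0 φ * y lam 0 φ)) := by rw [← y_mul_z]; rfl
  have h2 : perF lam 0 φ (z lam 0 φ) 2 = 0 := rfl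
  refine ⟨isHochschildTwoCocycle_defF_one lam φ, fun p q i j => ?_, fun p i j hj => ?_,
    fun p i j hj => ?_, fun p q i j => ?_⟩
  · have hs : ∀ r ∈ Finset.range i, ∀ s ∈ Finset.range q,
        z lam 0 φ ^ p * sigmaZ lam 0 φ q ^ (i - 1 - r) * x lam 0 φ ^ (q - 1 - s) *
          ((lam : k) • (z lam 0 φ * x lam 0 φ)) *
            (((lam : k) • x lam 0 φ) ^ s * z lam 0 φ ^ r * x lam 0 φ ^ j) =
        (lam : k) ^ (q * i) • (z lam 0 φ ^ (p + i) * x lam 0 φ ^ (q + j)) := by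
      intro r hr s hs
      have hi : i = (i - 1 - r) + 1 + r := by have := Finset.mem_range.1 hr; omega
      have hq : q = (q - 1 - s) + 1 + s := by have := Finset.mem_range.1 hs; omega
      have h := monomial_insert (x_mul_z lam φ) p (i - 1 - r) (q - 1 - s) s r j
      rw [← hi, ← hq] at h
      rw [sigmaZ_natCast, h]
    rw [defF_one_x_x, perEval, Fin.sum_univ_four]
    simp only [thetaXX, Matrix.cons_val, act_neg_right, map_sum, map_zero, act_tmul, h0,
      add_zero]
    rw [Finset.sum_congr rfl fun r hr => Finset.sum_congr rfl (hs r hr)]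
    simp [← Nat.cast_smul_eq_nsmul k, smul_smul, mul_assoc]
  · obtain ⟨j, rfl⟩ := Nat.exists_eq_add_of_le' hj
    have hs : ∀ r ∈ Finset.range i, z lam 0 φ ^ p * sigmaZ lam 0 φ 1 ^ (i - 1 - r) *
          ((lam : k) • (z lam 0 φ * x lam 0 φ)) * (z lam 0 φ ^ r * y lam 0 φ ^ (j + 1)) =
        (lam : k) ^ i • (z lam 0 φ ^ (p + i) * x lam 0 φ * y lam 0 φ ^ (j + 1)) := by
      intro r hr
      have hi : i = (i - 1 - r) + 1 + r := by have := Finset.mem_range.1 hr; omega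
      have h := monomial_insert (x_mul_z lam φ) p (i - 1 - r) 0 0 r 0
      rw [← hi] at h
      have hz := sigmaZ_natCast lam φ 1
      rw [Nat.cast_one] at hz
      simp only [zero_add, add_zero, one_mul, pow_zero, mul_one, pow_one] at h hz
      rw [hz, ← mul_assoc, h, smul_mul_assoc]
    have hz := sigmaZ_natCast lam φ 1
    rw [Nat.cast_one, pow_one] at hz
    rw [defF_one_x_y, perEval, Fin.sum_univ_four]
    simp only [thetaXY, Matrix.cons_val, act_neg_right, map_sum, map_zero, act_tmul, h0,
      add_zero,
      perF_three, Nat.add_sub_cancel]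
    rw [Finset.sum_congr rfl hs, hz, smul_pow]
    simp [← Nat.cast_smul_eq_nsmul k, pow_add, mul_assoc, PolyGWA.mul_neg, PolyGWA.neg_mul]
  · obtain ⟨j, rfl⟩ := Nat.exists_eq_add_of_le' hj
    have hs : ∀ r ∈ Finset.range i, z lam 0 φ ^ p * sigmaZ lam 0 φ (-1) ^ (i - 1 - r) *
          (((lam⁻¹ : kˣ) : k) • (z lam 0 φ * y lam 0 φ)) *
            (z lam 0 φ ^ r * x lam 0 φ ^ (j + 1)) =
        ((lam⁻¹ : kˣ) : k) ^ i •
          (z lam 0 φ ^ (p + i) * y lam 0 φ * x lam 0 φ ^ (j + 1)) := by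
      intro r hr
      have hi : i = (i - 1 - r) + 1 + r := by have := Finset.mem_range.1 hr; omega
      have h := monomial_insert (y_mul_z lam φ) p (i - 1 - r) 0 0 r 0
      rw [← hi] at h
      have hz := sigmaZ_neg_natCast lam φ 1
      rw [Nat.cast_one] at hz
      simp only [zero_add, add_zero, one_mul, pow_zero, mul_one, pow_one] at h hz
      rw [hz, ← mul_assoc, h, smul_mul_assoc]
    rw [defF_one_y_x, perEval, Fin.sum_univ_four]
    simp only [thetaYX, Matrix.cons_val, act_neg_right, act_neg_left, h1, h2, act_zero, map_zero,
      add_zero, zero_add, neg_neg]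
    simp only [map_sum, act_tmul]
    rw [Finset.sum_congr rfl hs]
    simp [← Nat.cast_smul_eq_nsmul k]
  · have hs : ∀ r ∈ Finset.range i, ∀ s ∈ Finset.range q,
        z lam 0 φ ^ p * sigmaZ lam 0 φ (-q) ^ (i - 1 - r) * y lam 0 φ ^ (q - 1 - s) *
          (((lam⁻¹ : kˣ) : k) • (z lam 0 φ * y lam 0 φ)) *
            ((((lam⁻¹ : kˣ) : k) • y lam 0 φ) ^ s * z lam 0 φ ^ r * y lam 0 φ ^ j) =
        ((lam⁻¹ : kˣ) : k) ^ (q * i) • (z lam 0 φ ^ (p + i) * y lam 0 φ ^ (q + j)) := by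
      intro r hr s hs
      have hi : i = (i - 1 - r) + 1 + r := by have := Finset.mem_range.1 hr; omega
      have hq : q = (q - 1 - s) + 1 + s := by have := Finset.mem_range.1 hs; omega
      have h := monomial_insert (y_mul_z lam φ) p (i - 1 - r) (q - 1 - s) s r j
      rw [← hi, ← hq] at h
      rw [sigmaZ_neg_natCast, h]
    rw [defF_one_y_y, perEval, Fin.sum_univ_four]
    simp only [thetaYY, Matrix.cons_val, act_neg_right, act_neg_left, h1, h2, map_zero,
      add_zero, zero_add, neg_neg]
    simp only [map_sum, act_tmul]
    rw [Finset.sum_congr rfl fun r hr => Finset.sum_congr rfl (hs r hr)]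
    simp [← Nat.cast_smul_eq_nsmul k, smul_smul, mul_assoc]

end Correspondence

end PolyGWA

/-! ### Uniqueness -/

section Uniqueness

variable {k A : Type*} [CommRing k] [Ring A] [Algebra k A] {G G' : HochschildTwo k A}

theorem apply_mul_left_of_hochschildB (G : HochschildTwo k A) (a b c : A) :
    G (a * b) c = a * G b c + G a (b * c) - G a b * c - hochschildB G a b c := by
  rw [hochschildB]; abel

theorem apply_mul_right_of_hochschildB (G : HochschildTwo k A) (a b c : A) :
    G a (b * c) = hochschildB G a b c - a * G b c + G (a * b) c + G a b * c := by
  rw [hochschildB]; abel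

/-- Two cochains with the same coboundary are equal if they agree when their first argument is one
of the generators of `A`. -/
theorem HochschildTwo.ext_of_hochschildB_eq {s : Set A} (hs : Algebra.adjoin k s = ⊤)
    (hB : ∀ a b c, hochschildB G a b c = hochschildB G' a b c) (h1 : G 1 = G' 1)
    (h : ∀ a ∈ s, G a = G' a) : G = G' := by
  refine LinearMap.ext fun a => ?_
  have ha : a ∈ Algebra.adjoin k s := by rw [hs]; trivial
  induction ha using Algebra.adjoin_induction with
  | mem a ha => exact h a ha
  | algebraMap r => rw [Algebra.algebraMap_eq_smul_one, map_smul, map_smul, h1]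
  | add a b _ _ ha hb => rw [map_add, map_add, ha, hb]
  | mul a b _ _ ha hb =>
    refine LinearMap.ext fun c => ?_
    rw [apply_mul_left_of_hochschildB, apply_mul_left_of_hochschildB G', ha, hb, hB]

variable {Z U V : A}

theorem apply_aeval_eq_zero (h1 : ∀ v, G 1 v = 0) (hZ : ∀ u v, G (Z * u) v = Z * G u v)
    (p : k[X]) (v : A) : G (Polynomial.aeval Z p) v = 0 := by
  have hpow : ∀ n, G (Z ^ n) v = 0 := by
    intro n
    induction n with
    | zero => rw [pow_zero, h1]
    | succ n ih => rw [pow_succ', hZ, ih, mul_zero]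
  induction p using Polynomial.induction_on' with
  | add p q hp hq => rw [map_add, map_add, LinearMap.add_apply, hp, hq, add_zero]
  | monomial n c =>
    rw [← Polynomial.smul_X_eq_monomial, map_smul, map_pow, Polynomial.aeval_X, map_smul,
      LinearMap.smul_apply, hpow, smul_zero]

/-- The step of the uniqueness proof that evaluates cochains at `(U, Z ^ i W ^ j)`, where `W` is
`U` or `V`. -/
theorem apply_pow_mul_pow_eq (hB : ∀ a b c, hochschildB G a b c = hochschildB G' a b c)
    (h1 : ∀ v, G 1 v = 0) (h1' : ∀ v, G' 1 v = 0)
    (hZ : ∀ u v, G (Z * u) v = Z * G u v) (hZ' : ∀ u v, G' (Z * u) v = Z * G' u v)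
    {c : k} (hUZ : U * Z = c • (Z * U)) (hGUZ : G U Z = G' U Z) (hGU : G U 1 = G' U 1) {W : A}
    (hW : ∀ j : ℕ, G U (W ^ j) = G' U (W ^ j)) (i j : ℕ) :
    G U (Z ^ i * W ^ j) = G' U (Z ^ i * W ^ j) := by
  have hpow : ∀ (F : HochschildTwo k A), (∀ v, F 1 v = 0) → (∀ u v, F (Z * u) v = Z * F u v) →
      ∀ n v, F (Z ^ n) v = 0 := fun F hF hF' n v => by
    simpa using apply_aeval_eq_zero hF hF' (Polynomial.X ^ n) v
  have hmul : ∀ (F : HochschildTwo k A), (∀ u v, F (Z * u) v = Z * F u v) →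
      ∀ n u v, F (Z ^ n * u) v = Z ^ n * F u v := by
    intro F hF n u v
    induction n with
    | zero => simp
    | succ n ih => rw [pow_succ', mul_assoc, hF, ih, mul_assoc]
  have hcomm : ∀ n, U * Z ^ n = c ^ n • (Z ^ n * U) := fun n => by
    simpa using pow_mul_pow_of_mul_eq_smul hUZ 1 n
  have hGZ : ∀ n : ℕ, G U (Z ^ n) = G' U (Z ^ n) := by
    intro n
    induction n with
    | zero => rwa [pow_zero]
    | succ n ih =>
      have hz : ∀ v, G Z v = 0 := fun v => by simpa using hpow G h1 hZ 1 v
      have hz' : ∀ v, G' Z v = 0 := fun v => by simpa using hpow G' h1' hZ' 1 v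
      rw [pow_succ', apply_mul_right_of_hochschildB, apply_mul_right_of_hochschildB G', hB, hz, hz',
        hUZ, map_smul, map_smul, LinearMap.smul_apply, LinearMap.smul_apply, hZ, hZ', ih, hGUZ]
  rw [apply_mul_right_of_hochschildB, apply_mul_right_of_hochschildB G', hB, hpow G h1 hZ,
    hpow G' h1' hZ', hcomm, map_smul, map_smul, LinearMap.smul_apply, LinearMap.smul_apply,
    hmul G hZ, hmul G' hZ', hGZ, hW]

/-- If `U V` is a polynomial in `Z`, then `G(U, V ^ j)` is determined by the coboundary of `G`, by
`G(U, V)` and by the `G(V, V ^ j)`. -/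
theorem apply_pow_eq (hB : ∀ a b c, hochschildB G a b c = hochschildB G' a b c)
    (h1 : ∀ v, G 1 v = 0) (h1' : ∀ v, G' 1 v = 0)
    (hZ : ∀ u v, G (Z * u) v = Z * G u v) (hZ' : ∀ u v, G' (Z * u) v = Z * G' u v)
    {p : k[X]} (hUV : U * V = Polynomial.aeval Z p) (hGUV : G U V = G' U V)
    (hGU : G U 1 = G' U 1) (hV : ∀ j : ℕ, G V (V ^ j) = G' V (V ^ j)) (j : ℕ) :
    G U (V ^ j) = G' U (V ^ j) := by
  rcases j with _ | j
  · rwa [pow_zero]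
  · rw [pow_succ', apply_mul_right_of_hochschildB, apply_mul_right_of_hochschildB G', hB, hUV,
      apply_aeval_eq_zero h1 hZ, apply_aeval_eq_zero h1' hZ', hV, hGUV]

end Uniqueness

namespace PolyGWA

/-- The correspondence prescribes `F(a, b)` for all monomials `b` as soon as `a` is `1`, `x`, `y` or
`z`, and thereby the cocycle `F`. -/
theorem CorrespondsTo.unique {k : Type*} [CommRing k] {lam : kˣ} {φ : k[X]}
    {m : Fin 4 → PolyGWA lam 0 φ} {G G' : HochschildTwo k (PolyGWA lam 0 φ)}
    (hG : CorrespondsTo lam 0 φ G m) (hG' : CorrespondsTo lam 0 φ G' m) : G = G' := by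
  obtain ⟨hB, hxx, hxy, hyx, hyy⟩ := hG
  obtain ⟨hB', hxx', hxy', hyx', hyy'⟩ := hG'
  refine HochschildTwo.ext_of_hochschildB_eq (adjoin_generators lam φ)
    (fun a b c => (hB a b c).trans (hB' a b c).symm) ?_ ?_
  · refine linearMap_ext_basisElt lam φ (fun i j => ?_) (fun i j _ => ?_)
    · simpa using (hxx 0 0 i j).trans (hxx' 0 0 i j).symm
    · simpa using (hyy 0 0 i j).trans (hyy' 0 0 i j).symm
  · rintro _ (rfl | rfl | rfl) <;>
      refine linearMap_ext_basisElt lam φ (fun i j => ?_) (fun i j hj => ?_)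
    · simpa using (hxx 1 0 i j).trans (hxx' 1 0 i j).symm
    · simpa using (hyy 1 0 i j).trans (hyy' 1 0 i j).symm
    · simpa using (hxx 0 1 i j).trans (hxx' 0 1 i j).symm
    · simpa using (hxy 0 i j hj).trans (hxy' 0 i j hj).symm
    · rcases j with _ | j
      · simpa using (hyy 0 1 i 0).trans (hyy' 0 1 i 0).symm
      · simpa using (hyx 0 i (j + 1) (by omega)).trans (hyx' 0 i (j + 1) (by omega)).symm
    · simpa using (hyy 0 1 i j).trans (hyy' 0 1 i j).symm

variable {k : Type*} [Field k] {lam : kˣ} {φ : k[X]}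

/-- A cochain that satisfies (a) and (b) is determined by its coboundary and by its values on the
pairs `(x, z)`, `(y, z)`, `(x, y)`, `(y, x)`. -/
theorem eq_of_hasValues {n : ℕ} {G G' : HochschildTwo k (PolyGWA lam 0 φ)}
    (hB : ∀ a b c, hochschildB G a b c = hochschildB G' a b c) (hA : CondA G) (hA' : CondA G')
    (hb : CondB lam 0 φ G) (hb' : CondB lam 0 φ G') (hv : HasValues lam φ n G)
    (hv' : HasValues lam φ n G') : G = G' := by
  obtain ⟨hr, hl⟩ := hA
  obtain ⟨hr', hl'⟩ := hA'
  obtain ⟨hZ, hpow⟩ := hb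
  obtain ⟨hZ', hpow'⟩ := hb'
  obtain ⟨hxz, hyz, hxy, hyx⟩ := hv
  obtain ⟨hxz', hyz', hxy', hyx'⟩ := hv'
  have hz : ∀ F : HochschildTwo k (PolyGWA lam 0 φ), (∀ v, F 1 v = 0) →
      (∀ u v, F (z lam 0 φ * u) v = z lam 0 φ * F u v) → ∀ v, F (z lam 0 φ) v = 0 :=
    fun F hF hF' v => by rw [← mul_one (z lam 0 φ), hF', hF, mul_zero]
  have hxp : ∀ j : ℕ, G (x lam 0 φ) (x lam 0 φ ^ j) = G' (x lam 0 φ) (x lam 0 φ ^ j) := fun j => by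
    simpa using (hpow 1 j).1.trans (hpow' 1 j).1.symm
  have hyp : ∀ j : ℕ, G (y lam 0 φ) (y lam 0 φ ^ j) = G' (y lam 0 φ) (y lam 0 φ ^ j) := fun j => by
    simpa using (hpow 1 j).2.trans (hpow' 1 j).2.symm
  refine HochschildTwo.ext_of_hochschildB_eq (adjoin_generators lam φ) hB
    (LinearMap.ext fun v => (hl v).trans (hl' v).symm) ?_
  rintro _ (rfl | rfl | rfl)
  · exact LinearMap.ext fun v => (hz G hl hZ v).trans (hz G' hl' hZ' v).symm
  · have hone := (hr (x lam 0 φ)).trans (hr' (x lam 0 φ)).symm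
    have key := fun (W : PolyGWA lam 0 φ) => apply_pow_mul_pow_eq hB hl hl' hZ hZ' (x_mul_z lam φ)
      (hxz.trans hxz'.symm) hone (W := W)
    refine linearMap_ext_basisElt lam φ (fun i j => key _ hxp i j) (fun i j _ => key _ ?_ i j)
    exact apply_pow_eq hB hl hl' hZ hZ' ((x_mul_y lam φ).trans (ofPoly_eq_aeval ..))
      (hxy.trans hxy'.symm) hone hyp
  · have hone := (hr (y lam 0 φ)).trans (hr' (y lam 0 φ)).symm
    have key := fun (W : PolyGWA lam 0 φ) => apply_pow_mul_pow_eq hB hl hl' hZ hZ' (y_mul_z lam φ)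
      (hyz.trans hyz'.symm) hone (W := W)
    refine linearMap_ext_basisElt lam φ (fun i j => key _ ?_ i j) (fun i j _ => key _ hyp i j)
    exact apply_pow_eq hB hl hl' hZ hZ' ((y_mul_x lam φ).trans (ofPoly_eq_aeval ..))
      (hyx.trans hyx'.symm) hone hxp

/-- The integrating equations give the coboundary of `F_n` in terms of the `F_i` with `i < n`. -/
theorem IsQuantumFamily.unique {F₁ : HochschildTwo k (PolyGWA lam 0 φ)}
    {G G' : ℕ → HochschildTwo k (PolyGWA lam 0 φ)} (hG : IsQuantumFamily lam φ F₁ G)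
    (hG' : IsQuantumFamily lam φ F₁ G') : G = G' := by
  obtain ⟨⟨h0, h1, hint⟩, hcond⟩ := hG
  obtain ⟨⟨h0', h1', hint'⟩, hcond'⟩ := hG'
  funext n
  induction n using Nat.strong_induction_on with
  | _ n ih =>
    rcases Nat.lt_or_ge n 2 with hn | hn
    · interval_cases n
      · rw [h0, h0']
      · rw [h1, h1']
    · obtain ⟨ha, hb, hv⟩ := hcond n hn
      obtain ⟨ha', hb', hv'⟩ := hcond' n hn
      refine eq_of_hasValues (fun a b c => ?_) ha ha' hb hb' hv hv'
      rw [← hint n hn, ← hint' n hn]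
      refine Finset.sum_congr rfl fun i hi => ?_
      rw [Finset.mem_Icc] at hi
      rw [bullet, bullet, ih i (by omega), ih (n - i) (by omega)]

theorem isQuantumFamily_defF [CharZero k] (lam : kˣ) (φ : k[X]) :
    IsQuantumFamily lam φ (defF lam φ 1) (defF lam φ) :=
  ⟨⟨defF_zero lam φ, rfl, fun _ hn => sum_bullet_defF lam φ (by omega)⟩, fun n hn =>
    ⟨(quantumDeformation lam φ).condA n (by omega), condB_defF lam φ (by omega),
      hasValues_defF lam φ hn⟩⟩

end PolyGWA

/-! ### Localization at `τ` -/

theorem deformedParam_ne_one {k : Type*} [Field k] {lam : kˣ} (hlam : lam ≠ 1) :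
    deformedParam lam ≠ 1 := by
  intro h
  have h1 := congrArg Units.val h
  rw [deformedParam, Units.val_mk0, Units.val_one, ← map_one (algebraMap k⟦X⟧ k⸨X⸩)] at h1
  have h2 := congrArg PowerSeries.constantCoeff (IsFractionRing.injective k⟦X⟧ k⸨X⸩ h1)
  -- The constant term of `(1 - τ) lam` is `lam`.
  simp at h2
  exact hlam h2

theorem Polynomial.map_hahnSeriesC {k : Type*} [Field k] (φ : k[X]) :
    φ.map (HahnSeries.C : k →+* k⸨X⸩) =
      (φ.map (PowerSeries.C : k →+* k⟦X⟧)).map (algebraMap k⟦X⟧ k⸨X⸩) := by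
  rw [Polynomial.map_map]
  congr 1
  ext1 c
  exact (HahnSeries.ofPowerSeries_C c).symm

theorem mainTheorem4 {k : Type*} [Field k] [CharZero k] (lam : kˣ) (hlam : lam ≠ 1)
    (φ : k[X]) (hφ : φ ≠ 0) :
    PolyGWA.IsPerTwoCocycle lam 0 φ (PolyGWA.perF lam 0 φ (PolyGWA.z lam 0 φ)) ∧
    ∃ F₁ : HochschildTwo k (PolyGWA lam 0 φ),
      (∀ G, PolyGWA.CorrespondsTo lam 0 φ G (PolyGWA.perF lam 0 φ (PolyGWA.z lam 0 φ)) ↔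
        G = F₁) ∧
      ∃ F : ℕ → HochschildTwo k (PolyGWA lam 0 φ),
        (∀ G, PolyGWA.IsQuantumFamily lam φ F₁ G ↔ G = F) ∧
        (∀ n, 1 ≤ n → PolyGWA.PreservesGam lam 0 φ (F n)) ∧
        ∃ D : UnitalFormalDeformation k (PolyGWA lam 0 φ), D.F = F ∧
          ∃ hD : IsLocallyFinite D.F,
            deformedParam lam ≠ 1 ∧
            ∃ e : D.Localized hD ≃ₐ[k⸨X⸩]
                PolyGWA (deformedParam lam) 0 (φ.map (HahnSeries.C : k →+* k⸨X⸩)),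
              e (1 ⊗ₜ D.inTilde hD (PolyGWA.x lam 0 φ)) = PolyGWA.x _ _ _ ∧
              e (1 ⊗ₜ D.inTilde hD (PolyGWA.y lam 0 φ)) = PolyGWA.y _ _ _ ∧
              e (1 ⊗ₜ D.inTilde hD (PolyGWA.z lam 0 φ)) = PolyGWA.z _ _ _ := by
  have hF₁ := PolyGWA.correspondsTo_defF_one lam φ
  have hF := PolyGWA.isQuantumFamily_defF lam φ
  have hD : IsLocallyFinite (PolyGWA.quantumDeformation lam φ).F :=
    Module.Basis.isLocallyFinite_inducedCochain _ _
  let ε := (PolyGWA.basis lam φ).equivTilde _ (PolyGWA.defLift_one lam φ)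
    (PolyGWA.defF_zero lam φ) hD
  let bc := PolyGWA.baseChange (lam := PolyGWA.deformedUnit lam) (lam' := deformedParam lam) rfl
    (Polynomial.map_hahnSeriesC φ)
  let e : (PolyGWA.quantumDeformation lam φ).Localized hD ≃ₐ[k⸨X⸩]
      PolyGWA (deformedParam lam) 0 (φ.map (HahnSeries.C : k →+* k⸨X⸩)) :=
    (Algebra.TensorProduct.congr AlgEquiv.refl ε.symm).trans bc
  have he : ∀ a, e (1 ⊗ₜ (PolyGWA.quantumDeformation lam φ).inTilde hD a) =
      bc (1 ⊗ₜ PolyGWA.defLift lam φ a) := fun a =>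
    congrArg (fun b => bc (1 ⊗ₜ b)) (Module.Basis.equivTilde_symm_inTilde ..)
  refine ⟨PolyGWA.isPerTwoCocycle_perF_z lam φ, PolyGWA.defF lam φ 1,
    fun G => ⟨fun hG => hG.unique hF₁, fun hG => hG ▸ hF₁⟩, PolyGWA.defF lam φ,
    fun G => ⟨fun hG => hG.unique hF, fun hG => hG ▸ hF⟩,
    fun n _ => PolyGWA.preservesGam_defF lam φ n, PolyGWA.quantumDeformation lam φ, rfl, hD,
    deformedParam_ne_one hlam, e, ?_, ?_, ?_⟩
  · rw [he, PolyGWA.defLift_x]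
    exact PolyGWA.baseChange_x ..
  · rw [he, PolyGWA.defLift_y]
    exact PolyGWA.baseChange_y ..
  · rw [he, PolyGWA.defLift_z]
    exact PolyGWA.baseChange_z ..
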